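/- All 2-categories, 2-functors, 2-natural transformations and modifications are strict. A 2-category $\mathcal A$ is *2-filtered* if * (F0) for all objects $A,B$ there are an object $E$ and arrows $A\to E$, $B\to E$; * (F1) for all arrows $f,g:A\to B$ there are an arrow $h:B\to E$ and an invertible 2-cell $hf\cong hg$; * (F2) for all 2-cells $\alpha,\beta:f\Rightarrow g:A\to B$ there is an arrow $h:B\to E$ with $h\alpha=h\beta$. Let $\mathcal C$ be a locally small 2-category. A *2-pro-object* of $\mathcal C$ is a 2-functor $X:\mathcal I^{op}\to\mathcal C$, where $\mathcal I$ is a small 2-filtered 2-category and $(-)^{op}$ reverses the 1-cells only; write $X=(X_i)_{i\in\mathcal I}$. For an object $B$ of $\mathcal C$ let $(LX)(B)=\operatorname{colim}_{i\in\mathcal I}\mathcal C(X_i,B)$ be the following category. Its objects are the pairs $(r,i)$ with $i\in\mathcal I$ and $r:X_i\to B$. A premorphism $(r,i)\to(s,j)$ is a triple $(u,\theta,v)$ with $u:i\to k$, $v:j\to k$ in $\mathcal I$ and a 2-cell $\theta:rX_u\Rightarrow sX_v$. A homotopy from $(u_1,\theta_1,v_1)$ to $(u_2,\theta_2,v_2)$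 consists of arrows $w_1,w_2$ of $\mathcal I$ with a common target and invertible 2-cells $\alpha:w_1v_1\Rightarrow w_2v_2$, $\beta:w_1u_1\Rightarrow w_2u_2$ such that $\theta_2X_{w_2}\circ rX_\beta=sX_\alpha\circ\theta_1X_{w_1}$. Homotopy is an equivalence relation; the morphisms of $(LX)(B)$ are the homotopy classes of premorphisms, composed by composing representatives. This makes $LX=\operatorname{colim}_i\mathcal C(X_i,-)$ a 2-functor $\mathcal C\to\mathcal Cat$. The 2-category $2\text{-}\mathcal Pro(\mathcal C)$ has the 2-pro-objects as objects and the hom categories $$2\text{-}\mathcal Pro(\mathcal C)(X,Y)=\mathcal Hom(\mathcal C,\mathcal Cat)(LY,LX)$$ of 2-natural transformations and modifications; an object $A$ of $\mathcal C$ is regarded as the 2-pro-object given by $\mathcal C(A,-)$. For a 2-pro-object $X=(X_i)_{i\in\mathcal I}$ let $\pi_i:X\to X_i$ be the projection given by the canonical inclusion $\mathcal C(X_i,-)\to LX$, $r\mapsto(r,i)$. Let $X=(X_i)_{i\in\mathcal I}$ and $Y=(Y_k)_{k\in\mathcal I'}$ be 2-pro-objects, and let $f,g:X\to Y$ be arrows.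 A pair $(r,\varphi)$ with $r:X_i\to Y_k$ in $\mathcal C$ *represents* $f$ if $\varphi$ is an invertible 2-cell $\pi_kf\Rightarrow r\pi_i$. If $(r,\varphi)$ represents $f$ and $(s,\psi)$ represents $g$, with $r,s:X_i\to Y_k$, then $(\theta,r,\varphi,s,\psi)$, with a 2-cell $\theta:r\Rightarrow s$, *represents* a 2-cell $\alpha:f\Rightarrow g$ if $\theta\pi_i\circ\varphi=\psi\circ\pi_k\alpha$. Let $\mathcal J$ be a small 2-filtered 2-category and $X:\mathcal J^{op}\to 2\text{-}\mathcal Pro(\mathcal C)$ a 2-functor, $X^j=(X^j_i)_{i\in\mathcal I_j}$. The 2-category $\mathcal K_X$ has * as 0-cells the pairs $(i,j)$ with $j\in\mathcal J$ and $i\in\mathcal I_j$; * as 1-cells $(i,j)\to(i',j')$ the triples $(a,r,\varphi)$ with $a:j\to j'$ in $\mathcal J$ and $r:X^{j'}_{i'}\to X^j_i$ in $\mathcal C$ such that $(r,\varphi)$ represents $X^a$; * as 2-cells $(a,r,\varphi)\Rightarrow(b,s,\psi)$ the pairs $(\alpha,\theta)$ with $\alpha:a\Rightarrow b$ in $\mathcal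 J$ and $\theta:r\Rightarrow s$ in $\mathcal C$ such that $(\theta,r,\varphi,s,\psi)$ represents $X^\alpha$; with the compositions $(a',r',\varphi')(a,r,\varphi)=(a'a,\,rr',\,r\varphi'\circ\varphi X^{a'})$, $(\alpha',\theta')(\alpha,\theta)=(\alpha'\alpha,\theta\theta')$ and $(\beta,\eta)\circ(\alpha,\theta)=(\beta\circ\alpha,\eta\circ\theta)$. **Proposition.** For every such diagram $X$ of 2-pro-objects, the 2-category $\mathcal K_X$ is 2-filtered, that is, it satisfies F0, F1 and F2. -/

import Mathlib

open CategoryTheory Bicategory Opposite Bicategory.Opposite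

universe w v u w₁ v₁ u₁ w₂ v₂ u₂ u₃

/-!
Conventions. A 2-category is a bicategory with `Bicategory.Strict`, a 2-functor is a
`StrictPseudofunctor`, and `Bᵒᵖ` reverses the 1-cells of `B` and keeps its 2-cells. Composition is
written in diagrammatic order.

The constructions that make sense for bicategories and pseudofunctors are carried out for these,
with the coherence isomorphisms written out; for 2-categories and 2-functors all of these
isomorphisms are identities (given by `eqToIso`).
-/

/-- A bicategory (in particular a 2-category) is *2-filtered* if it satisfies Kennison's
axioms F0, F1 and F2. -/
class IsTwoFiltered (A : Type u) [Bicategory.{w, v} A] : Prop where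
  /-- F0: two objects map to a common object. -/
  f0 : ∀ a b : A, ∃ e : A, Nonempty (a ⟶ e) ∧ Nonempty (b ⟶ e)
  /-- F1: two parallel arrows become isomorphic after composing with some arrow. -/
  f1 : ∀ {a b : A} (f g : a ⟶ b), ∃ (e : A) (h : b ⟶ e), Nonempty (f ≫ h ≅ g ≫ h)
  /-- F2: two parallel 2-cells become equal after composing with some arrow. -/
  f2 : ∀ {a b : A} {f g : a ⟶ b} (α β : f ⟶ g), ∃ (e : A) (h : b ⟶ e), α ▷ h = β ▷ h

/-!
The pseudocolimit `colim_i C(X_i, B)` of the 2-functor `C(X_-, B) : I ⥤ Cat`, for a 2-functor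
`X : Iᵒᵖ ⥤ C` with `I` 2-filtered: objects are pairs `(r, i)`, morphisms are homotopy classes of
premorphisms.
-/

namespace TwoColim

variable {I : Type v} [Bicategory.{v, v} I] {C : Type u} [Bicategory.{v, v} C]
  (X : Iᵒᵖ ⥤ᵖ C)

/-- `X_u` for a 1-cell `u : i ⟶ k` of the index bicategory. -/
abbrev res {i k : I} (u : i ⟶ k) : X.obj (op k) ⟶ X.obj (op i) := X.map u.op

variable {B : C}

/-- `X_β ≫ r`, for a 2-cell `β` of the index bicategory. -/
def act {i k : I} {u u' : i ⟶ k} (β : u ⟶ u') (r : X.obj (op i) ⟶ B) :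
    res X u ≫ r ⟶ res X u' ≫ r :=
  X.map₂ (op2 β) ▷ r

/-- The comparison `X_{u ≫ w} ≫ r ≅ X_w ≫ (X_u ≫ r)`
(an identity for a 2-functor between 2-categories). -/
def cmp {i k m : I} (u : i ⟶ k) (w : k ⟶ m) (r : X.obj (op i) ⟶ B) :
    res X (u ≫ w) ≫ r ≅ res X w ≫ res X u ≫ r :=
  whiskerRightIso (X.mapComp w.op u.op) r ≪≫ α_ _ _ _

/-- The image under `X_w ≫ -` of a 2-cell `θ : X_u ≫ r ⟶ X_v ≫ s`, regarded as a 2-cell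
`X_{u ≫ w} ≫ r ⟶ X_{v ≫ w} ≫ s`. -/
def push {i j k m : I} {u : i ⟶ k} {v : j ⟶ k} {r : X.obj (op i) ⟶ B} {s : X.obj (op j) ⟶ B}
    (w : k ⟶ m) (θ : res X u ≫ r ⟶ res X v ≫ s) :
    res X (u ≫ w) ≫ r ⟶ res X (v ≫ w) ≫ s :=
  (cmp X u w r).hom ≫ res X w ◁ θ ≫ (cmp X v w s).inv

section
variable {X}

@[simp] lemma act_id {i k : I} (u : i ⟶ k) (r : X.obj (op i) ⟶ B) :
    act X (𝟙 u) r = 𝟙 _ := by simp [act]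

@[simp]
lemma act_comp {i k : I} {u u' u'' : i ⟶ k} (β : u ⟶ u') (β' : u' ⟶ u'')
    (r : X.obj (op i) ⟶ B) : act X (β ≫ β') r = act X β r ≫ act X β' r := by simp [act]

lemma act_comp_assoc {i k : I} {u u' u'' : i ⟶ k} (β : u ⟶ u') (β' : u' ⟶ u'')
    (r : X.obj (op i) ⟶ B) {Z : X.obj (op k) ⟶ B} (h : res X u'' ≫ r ⟶ Z) :
    act X (β ≫ β') r ≫ h = act X β r ≫ act X β' r ≫ h := by simp

lemma push_id {i k m : I} (u : i ⟶ k) (w : k ⟶ m) (r : X.obj (op i) ⟶ B) :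
    push X w (𝟙 (res X u ≫ r)) = 𝟙 _ := by simp [push]

lemma push_comp {i j l k m : I} {u : i ⟶ k} {v : j ⟶ k} {z : l ⟶ k} {r : X.obj (op i) ⟶ B}
    {s : X.obj (op j) ⟶ B} {t : X.obj (op l) ⟶ B} (w : k ⟶ m)
    (θ : res X u ≫ r ⟶ res X v ≫ s) (η : res X v ≫ s ⟶ res X z ≫ t) :
    push X w (θ ≫ η) = push X w θ ≫ push X w η := by simp [push]

lemma push_act {i k m : I} {u u' : i ⟶ k} (w : k ⟶ m) (β : u ⟶ u') (r : X.obj (op i) ⟶ B) :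
    push X w (act X β r) = act X (β ▷ w) r := by
  simp [push, act, cmp]

lemma act_whiskerLeft {i k m : I} (u : i ⟶ k) {w z : k ⟶ m} (γ : w ⟶ z)
    (r : X.obj (op i) ⟶ B) :
    act X (u ◁ γ) r = (cmp X u w r).hom ≫ X.map₂ (op2 γ) ▷ (res X u ≫ r) ≫
      (cmp X u z r).inv := by
  simp [act, cmp]

lemma act_associator {i k m n : I} (u : i ⟶ k) (w : k ⟶ m) (z : m ⟶ n)
    (r : X.obj (op i) ⟶ B) :
    act X (α_ u w z).hom r = (cmp X (u ≫ w) z r).hom ≫ res X z ◁ (cmp X u w r).hom ≫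
      (α_ _ _ _).inv ≫ (X.mapComp z.op w.op).inv ▷ (res X u ≫ r) ≫
      (cmp X u (w ≫ z) r).inv := by
  have h := X.mapComp_assoc_left_inv z.op w.op u.op
  have h' : X.map₂ (op2 (α_ u w z).hom) = (X.mapComp z.op (w.op ≫ u.op)).hom ≫
      X.map z.op ◁ (X.mapComp w.op u.op).hom ≫ (α_ _ _ _).inv ≫
      (X.mapComp z.op w.op).inv ▷ X.map u.op ≫ (X.mapComp (z.op ≫ w.op) u.op).inv := by
    rw [h]; simp
  rw [act, h']
  simp [cmp]

lemma act_rightUnitor {i k : I} (u : i ⟶ k) (r : X.obj (op i) ⟶ B) :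
    act X (ρ_ u).hom r = (cmp X u (𝟙 k) r).hom ≫ (X.mapId (op k)).hom ▷ (res X u ≫ r) ≫
      (λ_ _).hom := by
  simp [act, cmp]

lemma push_push {i j k m n : I} {u : i ⟶ k} {v : j ⟶ k} {r : X.obj (op i) ⟶ B}
    {s : X.obj (op j) ⟶ B} (w : k ⟶ m) (z : m ⟶ n) (θ : res X u ≫ r ⟶ res X v ≫ s) :
    push X z (push X w θ) ≫ act X (α_ v w z).hom s =
      act X (α_ u w z).hom r ≫ push X (w ≫ z) θ := by
  simp only [act_associator, push, whiskerLeft_comp, Category.assoc, Iso.inv_hom_id_assoc,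
    whiskerLeft_inv_hom_assoc]
  have h : (X.mapComp z.op w.op).inv ▷ (res X u ≫ r) ≫ res X (w ≫ z) ◁ θ =
      (α_ _ _ _).hom ≫ res X z ◁ res X w ◁ θ ≫ (α_ _ _ _).inv ≫
        (X.mapComp z.op w.op).inv ▷ (res X v ≫ s) := by
    have := whisker_exchange (X.mapComp z.op w.op).inv θ
    simp only [comp_whiskerLeft, Category.assoc] at this
    exact this.symm
  rw [reassoc_of% h, Iso.inv_hom_id_assoc]

lemma push_exchange {i j k m : I} {u : i ⟶ k} {v : j ⟶ k} {r : X.obj (op i) ⟶ B}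
    {s : X.obj (op j) ⟶ B} {w z : k ⟶ m} (γ : w ⟶ z) (θ : res X u ≫ r ⟶ res X v ≫ s) :
    push X w θ ≫ act X (v ◁ γ) s = act X (u ◁ γ) r ≫ push X z θ := by
  simp only [act_whiskerLeft, push, Category.assoc, Iso.inv_hom_id_assoc]
  rw [whisker_exchange_assoc]

lemma push_one {i j k : I} {u : i ⟶ k} {v : j ⟶ k} {r : X.obj (op i) ⟶ B}
    {s : X.obj (op j) ⟶ B} (θ : res X u ≫ r ⟶ res X v ≫ s) :
    push X (𝟙 k) θ ≫ act X (ρ_ v).hom s = act X (ρ_ u).hom r ≫ θ := by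
  simp only [act_rightUnitor, push, Category.assoc, Iso.inv_hom_id_assoc]
  rw [whisker_exchange_assoc]
  simp
  rfl


instance {i k : I} {u u' : i ⟶ k} (β : u ⟶ u') [IsIso β] (r : X.obj (op i) ⟶ B) :
    IsIso (act X β r) :=
  ⟨act X (inv β) r, by rw [← act_comp]; simp, by rw [← act_comp]; simp⟩

@[simp]
lemma act_hom_inv {i k : I} {u u' : i ⟶ k} (β : u ≅ u') (r : X.obj (op i) ⟶ B) :
    act X β.hom r ≫ act X β.inv r = 𝟙 _ := by rw [← act_comp]; simp

@[simp]
lemma act_hom_inv_assoc {i k : I} {u u' : i ⟶ k} (β : u ≅ u') (r : X.obj (op i) ⟶ B)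
    {Z : X.obj (op k) ⟶ B} (h : res X u ≫ r ⟶ Z) :
    act X β.hom r ≫ act X β.inv r ≫ h = h := by rw [← act_comp_assoc]; simp

@[simp]
lemma act_inv_hom {i k : I} {u u' : i ⟶ k} (β : u ≅ u') (r : X.obj (op i) ⟶ B) :
    act X β.inv r ≫ act X β.hom r = 𝟙 _ := by rw [← act_comp]; simp

@[simp]
lemma act_inv_hom_assoc {i k : I} {u u' : i ⟶ k} (β : u ≅ u') (r : X.obj (op i) ⟶ B)
    {Z : X.obj (op k) ⟶ B} (h : res X u' ≫ r ⟶ Z) :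
    act X β.inv r ≫ act X β.hom r ≫ h = h := by rw [← act_comp_assoc]; simp

/-- `push`, followed by a change of the legs. -/
def mv {i j k m : I} {u : i ⟶ k} {v : j ⟶ k} {r : X.obj (op i) ⟶ B} {s : X.obj (op j) ⟶ B}
    (w : k ⟶ m) {a : i ⟶ m} {b : j ⟶ m} (β : u ≫ w ≅ a) (α : v ≫ w ≅ b)
    (θ : res X u ≫ r ⟶ res X v ≫ s) : res X a ≫ r ⟶ res X b ≫ s :=
  act X β.inv r ≫ push X w θ ≫ act X α.hom s

section
variable {i j l k m n : I} {u : i ⟶ k} {v : j ⟶ k} {z : l ⟶ k} {r : X.obj (op i) ⟶ B}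
  {s : X.obj (op j) ⟶ B} {t : X.obj (op l) ⟶ B}

lemma mv_comp (w : k ⟶ m) {a : i ⟶ m} {b : j ⟶ m} {c : l ⟶ m} (β : u ≫ w ≅ a)
    (α : v ≫ w ≅ b) (ζ : z ≫ w ≅ c) (θ : res X u ≫ r ⟶ res X v ≫ s)
    (η : res X v ≫ s ⟶ res X z ≫ t) :
    mv w β ζ (θ ≫ η) = mv w β α θ ≫ mv w α ζ η := by
  simp [mv, push_comp]

lemma mv_id (w : k ⟶ m) {a : i ⟶ m} (β : u ≫ w ≅ a) : mv w β β (𝟙 (res X u ≫ r)) = 𝟙 _ := by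
  simp [mv, push_id]

lemma mv_refl (w : k ⟶ m) (θ : res X u ≫ r ⟶ res X v ≫ s) :
    mv w (Iso.refl _) (Iso.refl _) θ = push X w θ := by
  simp [mv]

lemma mv_one (θ : res X u ≫ r ⟶ res X v ≫ s) : mv (𝟙 k) (ρ_ u) (ρ_ v) θ = θ := by
  simp [mv, push_one]

lemma mv_congr {w w' : k ⟶ m} (γ : w ≅ w') {a : i ⟶ m} {b : j ⟶ m} (β : u ≫ w ≅ a)
    (α : v ≫ w ≅ b) (θ : res X u ≫ r ⟶ res X v ≫ s) :
    mv w' (whiskerLeftIso u γ.symm ≪≫ β) (whiskerLeftIso v γ.symm ≪≫ α) θ = mv w β α θ := by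
  have h := push_exchange γ.inv θ
  simp only [mv, Iso.trans_inv, Iso.trans_hom, whiskerLeftIso_inv, whiskerLeftIso_hom,
    Iso.symm_hom, Iso.symm_inv, act_comp, Category.assoc]
  rw [reassoc_of% h, ← act_comp_assoc (u ◁ γ.hom)]
  simp

lemma mv_mv (w : k ⟶ m) (y : m ⟶ n) {a : i ⟶ m} {b : j ⟶ m} (β : u ≫ w ≅ a)
    (α : v ≫ w ≅ b) {a' : i ⟶ n} {b' : j ⟶ n} (β' : a ≫ y ≅ a') (α' : b ≫ y ≅ b')
    (θ : res X u ≫ r ⟶ res X v ≫ s) :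
    mv y β' α' (mv w β α θ) =
      mv (w ≫ y) ((α_ _ _ _).symm ≪≫ whiskerRightIso β y ≪≫ β')
        ((α_ _ _ _).symm ≪≫ whiskerRightIso α y ≪≫ α') θ := by
  have h := push_push w y θ
  simp only [mv, Iso.trans_inv, Iso.trans_hom, whiskerRightIso_inv, whiskerRightIso_hom,
    Iso.symm_hom, Iso.symm_inv, act_comp, Category.assoc, push_comp, push_act]
  rw [← reassoc_of% h, act_hom_inv_assoc]

lemma mv_change (w : k ⟶ m) {a a' : i ⟶ m} {b : j ⟶ m} (β : u ≫ w ≅ a) (β' : u ≫ w ≅ a')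
    (α : v ≫ w ≅ b) (θ : res X u ≫ r ⟶ res X v ≫ s) :
    mv w β α θ = act X (β.inv ≫ β'.hom) r ≫ mv w β' α θ := by
  simp [mv]

/-- The comparison of two legs moved along isomorphic 1-cells. -/
def leg {k' : I} {w : k ⟶ m} {w' : k ⟶ k'} {y : m ⟶ n} {y' : k' ⟶ n} (γ : w ≫ y ≅ w' ≫ y')
    {a : i ⟶ m} {a' : i ⟶ k'} (β : u ≫ w ≅ a) (β' : u ≫ w' ≅ a') : a' ≫ y' ≅ a ≫ y :=
  (whiskerRightIso β' y').symm ≪≫ α_ _ _ _ ≪≫ whiskerLeftIso u γ.symm ≪≫ (α_ _ _ _).symm ≪≫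
    whiskerRightIso β y

lemma mv_leg {k' : I} {w : k ⟶ m} {w' : k ⟶ k'} {y : m ⟶ n} {y' : k' ⟶ n}
    (γ : w ≫ y ≅ w' ≫ y') {a : i ⟶ m} {a' : i ⟶ k'} (β : u ≫ w ≅ a) (β' : u ≫ w' ≅ a')
    {b : j ⟶ m} {b' : j ⟶ k'} (α : v ≫ w ≅ b) (α' : v ≫ w' ≅ b')
    (θ : res X u ≫ r ⟶ res X v ≫ s) :
    mv y' (leg γ β β') (leg γ α α') (mv w' β' α' θ) =
      mv y (Iso.refl _) (Iso.refl _) (mv w β α θ) := by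
  rw [mv_mv, mv_mv, ← mv_congr γ]
  congr 1 <;> ext <;> simp [leg]

end

end

/-- Objects of the pseudocolimit of the categories `C(X_i, B)`: pairs `(r, i)` with
`r : X_i ⟶ B`. -/
@[ext] structure Obj (B : C) where
  idx : I
  arr : X.obj (op idx) ⟶ B

/-- Premorphisms `(r, i) ⟶ (s, j)`: triples `(u, θ, v)` with `u : i ⟶ k`, `v : j ⟶ k` and
`θ : X_u ≫ r ⟶ X_v ≫ s`. -/
structure Premor (x y : Obj X B) where
  top : I
  left : x.idx ⟶ top
  right : y.idx ⟶ top
  cell : res X left ≫ x.arr ⟶ res X right ≫ y.arr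

variable {X}

/-- There is a homotopy between the premorphisms `p` and `q`. -/
def Homotopic {x y : Obj X B} (p q : Premor X x y) : Prop :=
  ∃ (m : I) (w₁ : p.top ⟶ m) (w₂ : q.top ⟶ m) (α : p.right ≫ w₁ ≅ q.right ≫ w₂)
    (β : p.left ≫ w₁ ≅ q.left ≫ w₂),
    act X β.hom x.arr ≫ push X w₂ q.cell = push X w₁ p.cell ≫ act X α.hom y.arr

/-- Auxiliary: `q` is obtained from `p` by moving it along a 1-cell of the index. -/
def Exp {x y : Obj X B} (p q : Premor X x y) : Prop :=
  ∃ (w : p.top ⟶ q.top) (β : p.left ≫ w ≅ q.left) (α : p.right ≫ w ≅ q.right),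
    mv w β α p.cell = q.cell

lemma Exp.refl {x y : Obj X B} (p : Premor X x y) : Exp p p :=
  ⟨𝟙 _, ρ_ _, ρ_ _, mv_one _⟩

lemma Exp.trans {x y : Obj X B} {p q r : Premor X x y} (h : Exp p q) (h' : Exp q r) :
    Exp p r := by
  obtain ⟨w, β, α, e⟩ := h
  obtain ⟨z, β', α', e'⟩ := h'
  refine ⟨w ≫ z, _, _, (mv_mv w z β α β' α' _).symm.trans (by rw [e, e'])⟩

lemma Exp.homotopic {x y : Obj X B} {p q r : Premor X x y} (h : Exp p r) (h' : Exp q r) :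
    Homotopic p q := by
  obtain ⟨w, β, α, e⟩ := h
  obtain ⟨z, β', α', e'⟩ := h'
  refine ⟨_, w, z, α ≪≫ α'.symm, β ≪≫ β'.symm, ?_⟩
  rw [← e, mv, mv] at e'
  rw [← cancel_mono (act X α'.hom y.arr), ← cancel_epi (act X β.inv x.arr)]
  simpa using e'

lemma Homotopic.exp {x y : Obj X B} {p q : Premor X x y} (h : Homotopic p q) :
    ∃ r, Exp p r ∧ Exp q r := by
  obtain ⟨m, w₁, w₂, α, β, e⟩ := h
  refine ⟨⟨m, q.left ≫ w₂, q.right ≫ w₂, push X w₂ q.cell⟩, ⟨w₁, β, α, ?_⟩,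
    ⟨w₂, Iso.refl _, Iso.refl _, mv_refl _ _⟩⟩
  rw [mv, ← e]
  simp

/-- `r` is a composite of the premorphisms `p` and `q`: after moving `p` and `q` so that they
share the top object and the middle leg, `r` is the composite of the cells. -/
def IsComp {x y z : Obj X B} (p : Premor X x y) (q : Premor X y z) (r : Premor X x z) : Prop :=
  ∃ (m : I) (a : x.idx ⟶ m) (b : y.idx ⟶ m) (c : z.idx ⟶ m)
    (θ : res X a ≫ x.arr ⟶ res X b ≫ y.arr) (η : res X b ≫ y.arr ⟶ res X c ≫ z.arr),
    Exp p ⟨m, a, b, θ⟩ ∧ Exp q ⟨m, b, c, η⟩ ∧ r = ⟨m, a, c, θ ≫ η⟩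

lemma IsComp.of_exp {x y z : Obj X B} {p p' : Premor X x y} {q q' : Premor X y z}
    {r : Premor X x z} (h : IsComp p' q' r) (hp : Exp p p') (hq : Exp q q') : IsComp p q r := by
  obtain ⟨m, a, b, c, θ, η, h₁, h₂, h₃⟩ := h
  exact ⟨m, a, b, c, θ, η, hp.trans h₁, hq.trans h₂, h₃⟩

/-- The identity premorphism. -/
def idPre (x : Obj X B) : Premor X x x := ⟨x.idx, 𝟙 _, 𝟙 _, 𝟙 _⟩

lemma idPre_exp (x : Obj X B) {k : I} (u : x.idx ⟶ k) : Exp (idPre x) ⟨k, u, u, 𝟙 _⟩ :=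
  ⟨u, λ_ _, λ_ _, mv_id _ _⟩

section Filtered

variable [IsTwoFiltered I]

lemma exists_square {a b c : I} (f : a ⟶ b) (g : a ⟶ c) :
    ∃ (d : I) (h : b ⟶ d) (h' : c ⟶ d), Nonempty (f ≫ h ≅ g ≫ h') := by
  obtain ⟨e, ⟨s⟩, ⟨t⟩⟩ := IsTwoFiltered.f0 b c
  obtain ⟨d, h, ⟨γ⟩⟩ := IsTwoFiltered.f1 (f ≫ s) (g ≫ t)
  exact ⟨d, s ≫ h, t ≫ h, ⟨(α_ _ _ _).symm ≪≫ γ ≪≫ α_ _ _ _⟩⟩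

lemma exists_square₂ {a a' b c : I} (f : a ⟶ b) (g : a ⟶ c) (f' : a' ⟶ b) (g' : a' ⟶ c) :
    ∃ (d : I) (h : b ⟶ d) (h' : c ⟶ d), Nonempty (f ≫ h ≅ g ≫ h') ∧
      Nonempty (f' ≫ h ≅ g' ≫ h') := by
  obtain ⟨e, s, t, ⟨γ⟩⟩ := exists_square f g
  obtain ⟨d, h, ⟨δ⟩⟩ := IsTwoFiltered.f1 (f' ≫ s) (g' ≫ t)
  exact ⟨d, s ≫ h, t ≫ h, ⟨(α_ _ _ _).symm ≪≫ whiskerRightIso γ h ≪≫ α_ _ _ _⟩,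
    ⟨(α_ _ _ _).symm ≪≫ δ ≪≫ α_ _ _ _⟩⟩

lemma Exp.confluent {x y : Obj X B} {p q q' : Premor X x y} (h : Exp p q) (h' : Exp p q') :
    ∃ r, Exp q r ∧ Exp q' r := by
  obtain ⟨w, β, α, e⟩ := h
  obtain ⟨w', β', α', e'⟩ := h'
  obtain ⟨d, s, t, ⟨γ⟩⟩ := exists_square w w'
  refine ⟨⟨d, q.left ≫ s, q.right ≫ s, push X s q.cell⟩, ⟨s, Iso.refl _, Iso.refl _, mv_refl _ _⟩,
    ⟨t, leg γ β β', leg γ α α', ?_⟩⟩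
  rw [← e', mv_leg, e, mv_refl]

lemma homotopic_equivalence (x y : Obj X B) :
    Equivalence (Homotopic (x := x) (y := y)) where
  refl p := Exp.homotopic (Exp.refl p) (Exp.refl p)
  symm h := by
    obtain ⟨r, h₁, h₂⟩ := h.exp
    exact Exp.homotopic h₂ h₁
  trans h h' := by
    obtain ⟨r, h₁, h₂⟩ := h.exp
    obtain ⟨r', h₁', h₂'⟩ := h'.exp
    obtain ⟨t, k₁, k₂⟩ := h₂.confluent h₁'
    exact Exp.homotopic (h₁.trans k₁) (h₂'.trans k₂)

/-- Homotopy of premorphisms, as an equivalence relation. -/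
instance premorSetoid (x y : Obj X B) : Setoid (Premor X x y) :=
  ⟨Homotopic, homotopic_equivalence x y⟩

lemma exists_isComp {x y z : Obj X B} (p : Premor X x y) (q : Premor X y z) :
    ∃ r, IsComp p q r := by
  obtain ⟨d, s, t, ⟨γ⟩⟩ := exists_square p.right q.left
  exact ⟨_, d, p.left ≫ s, p.right ≫ s, q.right ≫ t, push X s p.cell,
    mv t γ.symm (Iso.refl _) q.cell, ⟨s, Iso.refl _, Iso.refl _, mv_refl _ _⟩,
    ⟨t, γ.symm, Iso.refl _, rfl⟩, rfl⟩

lemma IsComp.unique {x y z : Obj X B} {p : Premor X x y} {q : Premor X y z}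
    {r r' : Premor X x z} (h : IsComp p q r) (h' : IsComp p q r') : Homotopic r r' := by
  obtain ⟨m, a, b, c, θ, η, ⟨w₁, β₁, α₁, e₁⟩, ⟨w₂, α₂, ζ₂, e₂⟩, rfl⟩ := h
  obtain ⟨n, a', b', c', θ', η', ⟨w₁', β₁', α₁', e₁'⟩, ⟨w₂', α₂', ζ₂', e₂'⟩, rfl⟩ := h'
  obtain ⟨l, s, t, ⟨γ₁⟩, ⟨γ₂⟩⟩ := exists_square₂ w₁ w₁' w₂ w₂'
  obtain ⟨l', f, hf⟩ := IsTwoFiltered.f2 ((leg γ₁ α₁ α₁').inv ≫ (leg γ₂ α₂ α₂').hom) (𝟙 _)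
  dsimp only at e₁ e₂ e₁' e₂'
  let R : Premor X x z := ⟨l', (a ≫ s) ≫ f, (c ≫ s) ≫ f, push X f (push X s (θ ≫ η))⟩
  refine Exp.homotopic (r := R) (Exp.trans (q := ⟨l, a ≫ s, c ≫ s, push X s (θ ≫ η)⟩)
    ⟨s, Iso.refl _, Iso.refl _, mv_refl _ _⟩ ⟨f, Iso.refl _, Iso.refl _, mv_refl _ _⟩)
    (Exp.trans (q := ⟨l, a ≫ s, c ≫ s,
      mv t (leg γ₁ β₁ β₁') (leg γ₂ ζ₂ ζ₂') (θ' ≫ η')⟩)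
      ⟨t, _, _, rfl⟩ ⟨f, Iso.refl _, Iso.refl _, ?_⟩)
  dsimp only [R]
  rw [mv_refl, mv_comp t _ (leg γ₁ α₁ α₁') _, mv_change t (leg γ₁ α₁ α₁') (leg γ₂ α₂ α₂'),
    ← e₁', ← e₂', mv_leg, mv_leg, e₁, e₂, mv_refl, mv_refl, push_comp, push_comp, push_act, hf,
    push_comp, push_comp]
  simp

lemma IsComp.congr {x y z : Obj X B} {p p' : Premor X x y} {q q' : Premor X y z}
    {r r' : Premor X x z} (h : IsComp p q r) (h' : IsComp p' q' r') (hp : Homotopic p p')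
    (hq : Homotopic q q') : Homotopic r r' := by
  obtain ⟨p₀, hp₁, hp₂⟩ := hp.exp
  obtain ⟨q₀, hq₁, hq₂⟩ := hq.exp
  obtain ⟨r₀, h₀⟩ := exists_isComp p₀ q₀
  exact (homotopic_equivalence _ _).trans (h.unique (h₀.of_exp hp₁ hq₁))
    ((h₀.of_exp hp₂ hq₂).unique h')

/-- A chosen composite of two premorphisms. -/
noncomputable def compPre {x y z : Obj X B} (p : Premor X x y) (q : Premor X y z) :
    Premor X x z := (exists_isComp p q).choose

lemma isComp_compPre {x y z : Obj X B} (p : Premor X x y) (q : Premor X y z) :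
    IsComp p q (compPre p q) := (exists_isComp p q).choose_spec

lemma compPre_assoc {x y z t : Obj X B} (p : Premor X x y) (q : Premor X y z)
    (r : Premor X z t) :
    Homotopic (compPre (compPre p q) r) (compPre p (compPre q r)) := by
  obtain ⟨m, a, b, c, θ, η, h₁, h₂, -⟩ := isComp_compPre p q
  obtain ⟨n, s, s', ⟨γ⟩⟩ := exists_square c r.left
  have p₁ : Exp p ⟨n, a ≫ s, b ≫ s, push X s θ⟩ :=
    h₁.trans ⟨s, Iso.refl _, Iso.refl _, mv_refl _ _⟩
  have q₁ : Exp q ⟨n, b ≫ s, c ≫ s, push X s η⟩ :=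
    h₂.trans ⟨s, Iso.refl _, Iso.refl _, mv_refl _ _⟩
  have r₁ : Exp r ⟨n, c ≫ s, r.right ≫ s', mv s' γ.symm (Iso.refl _) r.cell⟩ :=
    ⟨s', γ.symm, Iso.refl _, rfl⟩
  have pq : IsComp p q _ := ⟨n, _, _, _, _, _, p₁, q₁, rfl⟩
  have qr : IsComp q r _ := ⟨n, _, _, _, _, _, q₁, r₁, rfl⟩
  have l := IsComp.congr (isComp_compPre (compPre p q) r)
    ⟨n, _, _, _, _, _, Exp.refl _, r₁, rfl⟩ ((isComp_compPre p q).unique pq)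
    ((homotopic_equivalence _ _).refl _)
  have l' := IsComp.congr (isComp_compPre p (compPre q r))
    ⟨n, _, _, _, _, _, p₁, Exp.refl _, rfl⟩ ((homotopic_equivalence _ _).refl _)
    ((isComp_compPre q r).unique qr)
  rw [Category.assoc] at l
  exact (homotopic_equivalence _ _).trans l ((homotopic_equivalence _ _).symm l')

/-- The pseudocolimit of the categories `C(X_i, B)`: its morphisms are the premorphisms up to
homotopy, composed by composing representatives. -/
noncomputable instance : Category.{v} (Obj X B) where
  Hom x y := Quotient (premorSetoid x y)
  id x := ⟦idPre x⟧
  comp := Quotient.map₂ compPre fun p p' hp q q' hq =>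
    IsComp.congr (isComp_compPre p q) (isComp_compPre p' q') hp hq
  id_comp := by
    rintro x y ⟨p⟩
    refine Quotient.sound (IsComp.unique (isComp_compPre _ _)
      ⟨_, p.left, p.left, p.right, _, _, idPre_exp x _, Exp.refl _, ?_⟩)
    simp
  comp_id := by
    rintro x y ⟨p⟩
    refine Quotient.sound (IsComp.unique (isComp_compPre _ _)
      ⟨_, p.left, p.right, p.right, _, _, Exp.refl _, idPre_exp y _, ?_⟩)
    simp
  assoc := by
    rintro x y z t ⟨p⟩ ⟨q⟩ ⟨r⟩
    exact Quotient.sound (compPre_assoc p q r)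

/-- The morphism represented by a premorphism. -/
def homMk {x y : Obj X B} (p : Premor X x y) : x ⟶ y := Quotient.mk (premorSetoid x y) p

lemma homMk_surjective {x y : Obj X B} (f : x ⟶ y) : ∃ p, homMk p = f := Quotient.exists_rep f

lemma homMk_eq_iff {x y : Obj X B} {p q : Premor X x y} : homMk p = homMk q ↔ Homotopic p q :=
  Quotient.eq (r := premorSetoid x y)

lemma homMk_eq_of_exp {x y : Obj X B} {p q : Premor X x y} (h : Exp p q) : homMk p = homMk q :=
  homMk_eq_iff.2 (h.homotopic (Exp.refl q))

lemma homMk_comp_of_isComp {x y z : Obj X B} {p : Premor X x y} {q : Premor X y z}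
    {r : Premor X x z} (h : IsComp p q r) : homMk p ≫ homMk q = homMk r :=
  homMk_eq_iff.2 ((isComp_compPre p q).unique h)

lemma homMk_idPre (x : Obj X B) : homMk (idPre x) = 𝟙 x := rfl

end Filtered

end TwoColim

namespace TwoColim

section Unfiltered

variable {I : Type v} [Bicategory.{v, v} I] {C : Type u} [Bicategory.{v, v} C]
  {X : Iᵒᵖ ⥤ᵖ C} {B B' : C}

lemma push_whisker {i k m : I} {r s : X.obj (op i) ⟶ B} (θ : r ⟶ s) (u : i ⟶ k) (w : k ⟶ m) :
    push X w (res X u ◁ θ) = res X (u ≫ w) ◁ θ := by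
  have h : res X (u ≫ w) ◁ θ ≫ (cmp X u w s).hom =
      (cmp X u w r).hom ≫ res X w ◁ res X u ◁ θ := by
    simp only [cmp, Iso.trans_hom, whiskerRightIso_hom]
    erw [whisker_exchange_assoc]
    simp
  rw [push, ← reassoc_of% h]
  simp

lemma incl_exp {i k : I} {r s : X.obj (op i) ⟶ B} (θ : r ⟶ s) (u : i ⟶ k) :
    Exp (x := (⟨i, r⟩ : Obj X B)) (y := ⟨i, s⟩) ⟨i, 𝟙 i, 𝟙 i, res X (𝟙 i) ◁ θ⟩
      ⟨k, u, u, res X u ◁ θ⟩ := by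
  refine ⟨u, λ_ u, λ_ u, ?_⟩
  have h : act X (λ_ u).hom r ≫ res X u ◁ θ = res X (𝟙 i ≫ u) ◁ θ ≫ act X (λ_ u).hom s := by
    simp only [act]
    rw [whisker_exchange]
  dsimp only [mv]
  rw [push_whisker, ← h]
  simp

/-- `θ ▷ g`, for a 2-cell `θ : X_u ≫ r ⟶ X_v ≫ s` and a 1-cell `g` of `C`, up to associators. -/
def wh (g : B ⟶ B') {i j k : I} {u : i ⟶ k} {v : j ⟶ k} {r : X.obj (op i) ⟶ B}
    {s : X.obj (op j) ⟶ B} (θ : res X u ≫ r ⟶ res X v ≫ s) :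
    res X u ≫ r ≫ g ⟶ res X v ≫ s ≫ g :=
  (α_ _ _ _).inv ≫ θ ▷ g ≫ (α_ _ _ _).hom

variable (g : B ⟶ B') {i j l k m : I} {u : i ⟶ k} {v : j ⟶ k} {z : l ⟶ k} {r : X.obj (op i) ⟶ B}
  {s : X.obj (op j) ⟶ B} {t : X.obj (op l) ⟶ B}

lemma wh_comp (θ : res X u ≫ r ⟶ res X v ≫ s) (η : res X v ≫ s ⟶ res X z ≫ t) :
    wh g (θ ≫ η) = wh g θ ≫ wh g η := by simp [wh]

lemma wh_id : wh g (𝟙 (res X u ≫ r)) = 𝟙 _ := by simp [wh]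

lemma wh_act {u' : i ⟶ k} (β : u ⟶ u') : wh g (act X β r) = act X β (r ≫ g) := by
  simp [wh, act]

lemma wh_push (w : k ⟶ m) (θ : res X u ≫ r ⟶ res X v ≫ s) :
    wh g (push X w θ) = push X w (wh g θ) := by
  simp [wh, push, cmp]
  rfl

lemma wh_mv (w : k ⟶ m) {a : i ⟶ m} {b : j ⟶ m} (β : u ≫ w ≅ a) (α : v ≫ w ≅ b)
    (θ : res X u ≫ r ⟶ res X v ≫ s) : wh g (mv w β α θ) = mv w β α (wh g θ) := by
  simp [mv, wh_comp, wh_push, wh_act]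

lemma wh_whisker {r r' : X.obj (op i) ⟶ B} (θ : r ⟶ r') (u : i ⟶ k) :
    wh g (res X u ◁ θ) = res X u ◁ (θ ▷ g) := by
  simp [wh]

lemma wh_exchange {g g' : B ⟶ B'} (γ : g ⟶ g') (θ : res X u ≫ r ⟶ res X v ≫ s) :
    wh g θ ≫ res X v ◁ s ◁ γ = res X u ◁ r ◁ γ ≫ wh g' θ := by
  have := whisker_exchange θ γ
  simp only [comp_whiskerLeft, Category.assoc] at this
  simp only [wh, Category.assoc]
  rw [← cancel_epi (α_ _ _ _).hom, ← cancel_mono (α_ _ _ _).inv]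
  simpa using this.symm

lemma wh_one (θ : res X u ≫ r ⟶ res X v ≫ s) :
    wh (𝟙 B) θ ≫ res X v ◁ (ρ_ s).hom = res X u ◁ (ρ_ r).hom ≫ θ := by
  simp [wh]

lemma wh_wh {B'' : C} (g' : B' ⟶ B'') (θ : res X u ≫ r ⟶ res X v ≫ s) :
    wh (g ≫ g') θ ≫ res X v ◁ (α_ s g g').inv =
      res X u ◁ (α_ r g g').inv ≫ wh g' (wh g θ) := by
  simp [wh]

/-- Postcomposition of a premorphism with a 1-cell of `C`. -/
def Premor.post {x y : Obj X B} (p : Premor X x y) :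
    Premor X (⟨x.idx, x.arr ≫ g⟩ : Obj X B') ⟨y.idx, y.arr ≫ g⟩ :=
  ⟨p.top, p.left, p.right, wh g p.cell⟩

lemma Exp.post {x y : Obj X B} {p q : Premor X x y} (h : Exp p q) :
    Exp (p.post g) (q.post g) := by
  obtain ⟨w, β, α, e⟩ := h
  exact ⟨w, β, α, by dsimp only [Premor.post]; rw [← wh_mv, e]⟩

lemma IsComp.post {x y z : Obj X B} {p : Premor X x y} {q : Premor X y z} {o : Premor X x z}
    (h : IsComp p q o) : IsComp (p.post g) (q.post g) (o.post g) := by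
  obtain ⟨m, a, b, c, θ, η, h₁, h₂, rfl⟩ := h
  exact ⟨m, a, b, c, wh g θ, wh g η, h₁.post g, h₂.post g, by simp [Premor.post, wh_comp]⟩

end Unfiltered

variable {I : Type v} [Bicategory.{v, v} I] [IsTwoFiltered I] {C : Type u} [Bicategory.{v, v} C]
  {X : Iᵒᵖ ⥤ᵖ C} {B B' : C}

section Inclusion

variable (X B) in
/-- The pseudocolimit inclusion `λ_i : C(X_i, B) ⥤ colim C(X_i, B)`. -/
def incl (i : I) : (X.obj (op i) ⟶ B) ⥤ Obj X B where
  obj r := ⟨i, r⟩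
  map {r s} θ := homMk ⟨i, 𝟙 i, 𝟙 i, res X (𝟙 i) ◁ θ⟩
  map_id r := by
    rw [whiskerLeft_id]; rfl
  map_comp {r s t} θ η := by
    symm
    apply homMk_comp_of_isComp
    exact ⟨_, _, _, _, _, _, Exp.refl _, Exp.refl _, by simp⟩

lemma incl_map {i k : I} {r s : X.obj (op i) ⟶ B} (θ : r ⟶ s) (u : i ⟶ k) :
    (incl X B i).map θ =
      homMk (x := (⟨i, r⟩ : Obj X B)) (y := ⟨i, s⟩) ⟨k, u, u, res X u ◁ θ⟩ :=
  homMk_eq_of_exp (incl_exp θ u)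

lemma incl_map_comp {i : I} {r s : X.obj (op i) ⟶ B} (θ : r ⟶ s) {y : Obj X B}
    (p : Premor X ⟨i, s⟩ y) :
    (incl X B i).map θ ≫ homMk p =
      homMk (x := (⟨i, r⟩ : Obj X B)) ⟨p.top, p.left, p.right, res X p.left ◁ θ ≫ p.cell⟩ := by
  rw [incl_map θ p.left]
  exact homMk_comp_of_isComp ⟨_, _, _, _, _, _, Exp.refl _, Exp.refl _, rfl⟩

lemma comp_incl_map {i : I} {r s : X.obj (op i) ⟶ B} (θ : r ⟶ s) {y : Obj X B}
    (p : Premor X y ⟨i, r⟩) :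
    homMk p ≫ (incl X B i).map θ =
      homMk (y := (⟨i, s⟩ : Obj X B)) ⟨p.top, p.left, p.right, p.cell ≫ res X p.right ◁ θ⟩ := by
  rw [incl_map θ p.right]
  exact homMk_comp_of_isComp ⟨_, _, _, _, _, _, Exp.refl _, Exp.refl _, rfl⟩

end Inclusion

section Postcomposition

variable (g : B ⟶ B') {i : I}

/-- The functor `colim C(X_i, B) ⥤ colim C(X_i, B')` induced by `g : B ⟶ B'`. -/
def post : Obj X B ⥤ Obj X B' where
  obj x := ⟨x.idx, x.arr ≫ g⟩
  map {x y} := Quotient.lift (fun p => homMk (p.post g)) fun p q h => by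
    obtain ⟨r, h₁, h₂⟩ := Homotopic.exp h
    exact (homMk_eq_of_exp (h₁.post g)).trans (homMk_eq_of_exp (h₂.post g)).symm
  map_id x := by
    change homMk ((idPre x).post g) = homMk (idPre _)
    simp only [Premor.post, idPre, wh_id]
  map_comp {x y z} f f' := by
    obtain ⟨p, rfl⟩ := homMk_surjective f
    obtain ⟨q, rfl⟩ := homMk_surjective f'
    exact (homMk_comp_of_isComp ((isComp_compPre p q).post g)).symm

lemma post_map_homMk {x y : Obj X B} (p : Premor X x y) :
    (post g).map (homMk p) = homMk (p.post g) := rfl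

lemma post_map_incl {r s : X.obj (op i) ⟶ B} (θ : r ⟶ s) :
    (post g).map ((incl X B i).map θ) = (incl X B' i).map (θ ▷ g) := by
  exact congrArg (fun c => homMk (x := (⟨i, r ≫ g⟩ : Obj X B')) (y := ⟨i, s ≫ g⟩)
    ⟨i, 𝟙 i, 𝟙 i, c⟩) (wh_whisker g θ (𝟙 i))

end Postcomposition

variable [Strict C]

lemma eqToHom_incl {i : I} {r s : X.obj (op i) ⟶ B} (h : r = s)
    (h' : (⟨i, r⟩ : Obj X B) = ⟨i, s⟩) : eqToHom h' = (incl X B i).map (eqToHom h) := by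
  rw [eqToHom_map]; rfl

lemma post_naturality {B B' : C} {g g' : B ⟶ B'} (γ : g ⟶ g') {x y : Obj X B} (f : x ⟶ y) :
    (post g).map f ≫ (incl X B' y.idx).map (y.arr ◁ γ) =
      (incl X B' x.idx).map (x.arr ◁ γ) ≫ (post g').map f := by
  obtain ⟨p, rfl⟩ := homMk_surjective f
  rw [post_map_homMk, post_map_homMk]
  refine (comp_incl_map (y.arr ◁ γ) (p.post g)).trans
    (Eq.trans ?_ (incl_map_comp (x.arr ◁ γ) (p.post g')).symm)
  exact congrArg (fun c => homMk (x := (⟨x.idx, x.arr ≫ g⟩ : Obj X B'))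
    (y := ⟨y.idx, y.arr ≫ g'⟩) ⟨p.top, p.left, p.right, c⟩) (wh_exchange γ p.cell)

lemma incl_map_eq {i : I} {r s r' s' : X.obj (op i) ⟶ B} (h : r = r') (h' : s = s')
    (θ : r ⟶ s) (θ' : r' ⟶ s') (e : θ = eqToHom h ≫ θ' ≫ eqToHom h'.symm) :
    (incl X B i).map θ = eqToHom (congrArg (Obj.mk i) h) ≫ (incl X B i).map θ' ≫
      eqToHom (congrArg (Obj.mk i) h'.symm) := by
  subst h h'
  obtain rfl : θ = θ' := by simpa using e
  simp only [eqToHom_refl]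
  erw [Category.id_comp, Category.comp_id]

lemma post_id : post (X := X) (𝟙 B) = 𝟭 _ := by
  refine Functor.ext_of_iso (NatIso.ofComponents (fun x => (incl X B x.idx).mapIso (ρ_ x.arr)) ?_)
    (fun x => ?_) (fun x => ?_)
  · intro x y f
    obtain ⟨p, rfl⟩ := homMk_surjective f
    refine (comp_incl_map (ρ_ y.arr).hom (p.post (𝟙 B))).trans
      (Eq.trans ?_ (incl_map_comp (ρ_ x.arr).hom p).symm)
    exact congrArg (fun c => homMk (x := (⟨x.idx, x.arr ≫ 𝟙 B⟩ : Obj X B))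
      (y := y) ⟨p.top, p.left, p.right, c⟩) (wh_one p.cell)
  · exact congrArg (Obj.mk x.idx) (Strict.comp_id x.arr)
  · refine Eq.trans ?_ (eqToHom_incl (Strict.comp_id x.arr) _).symm
    simp [Strict.rightUnitor_eqToIso]
    rfl

lemma post_comp {B'' : C} (g : B ⟶ B') (g' : B' ⟶ B'') :
    post (X := X) (g ≫ g') = post g ⋙ post g' := by
  refine Functor.ext_of_iso
    (NatIso.ofComponents (fun x => (incl X B'' x.idx).mapIso (α_ x.arr g g').symm) ?_)
    (fun x => ?_) (fun x => ?_)
  · intro x y f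
    obtain ⟨p, rfl⟩ := homMk_surjective f
    refine (comp_incl_map (α_ y.arr g g').inv (p.post (g ≫ g'))).trans
      (Eq.trans ?_ (incl_map_comp (α_ x.arr g g').inv ((p.post g).post g')).symm)
    exact congrArg (fun c => homMk (x := (⟨x.idx, x.arr ≫ g ≫ g'⟩ : Obj X B''))
      (y := ⟨y.idx, (y.arr ≫ g) ≫ g'⟩) ⟨p.top, p.left, p.right, c⟩) (wh_wh g g' p.cell)
  · exact congrArg (Obj.mk x.idx) (Strict.assoc x.arr g g').symm
  · refine Eq.trans ?_ (eqToHom_incl (Strict.assoc x.arr g g').symm _).symm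
    simp [Strict.associator_eqToIso]
    rfl

variable (X) in
/-- `L X = colim C(X_i, -)` -/
noncomputable def LPre : StrictPseudofunctorPreCore C Cat.{v, v} where
  obj B := Cat.of (Obj X B)
  map g := (post g).toCatHom
  map₂ {B B'} g g' γ := NatTrans.toCatHom₂
    { app x := (incl X B' x.idx).map (x.arr ◁ γ)
      naturality {x y} f := post_naturality γ f }
  map₂_id {B B'} g := by
    ext x
    change (incl X B' x.idx).map (x.arr ◁ 𝟙 g) = 𝟙 _
    simp
  map₂_comp {B B'} g g' g'' γ γ' := by
    ext x
    change (incl X B' x.idx).map (x.arr ◁ (γ ≫ γ')) =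
      (incl X B' x.idx).map (x.arr ◁ γ) ≫ (incl X B' x.idx).map (x.arr ◁ γ')
    simp
  map_id B := congrArg Functor.toCatHom post_id
  map_comp g g' := congrArg Functor.toCatHom (post_comp g g')
  map₂_whisker_left {B B' B''} g g' g'' γ := by
    ext x
    simp only [Cat.Hom₂.comp_app, Cat.eqToHom_app]
    exact incl_map_eq (Strict.assoc x.arr g g').symm (Strict.assoc x.arr g g'').symm _ _
      (by change _ = _ ≫ (x.arr ≫ g) ◁ γ ≫ _; simp [Strict.associator_eqToIso])
  map₂_whisker_right {B B' B''} g g' γ h := by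
    ext x
    simp only [Cat.Hom₂.comp_app, Cat.eqToHom_app]
    refine (incl_map_eq (Strict.assoc x.arr g h).symm (Strict.assoc x.arr g' h).symm _
      ((x.arr ◁ γ) ▷ h) (by simp [Strict.associator_eqToIso])).trans ?_
    rw [← post_map_incl]
    rfl

end TwoColim

section TwoFunctors

variable {A : Type u₁} [Bicategory.{w₁, v₁} A] {D : Type u₂} [Bicategory.{w₂, v₂} D]

/-- A 2-natural transformation between 2-functors. -/
structure TwoNat (F G : StrictPseudofunctor A D) where
  app (a : A) : F.obj a ⟶ G.obj a
  naturality {a b : A} (f : a ⟶ b) : F.map f ≫ app b = app a ≫ G.map f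
  naturality₂ {a b : A} {f g : a ⟶ b} (η : f ⟶ g) :
    F.map₂ η ▷ app b ≫ eqToHom (naturality g) = eqToHom (naturality f) ≫ app a ◁ G.map₂ η

/-- A modification between 2-natural transformations. -/
@[ext] structure TwoNat.Modif {F G : StrictPseudofunctor A D} (σ τ : TwoNat F G) where
  app (a : A) : σ.app a ⟶ τ.app a
  naturality {a b : A} (f : a ⟶ b) :
    F.map f ◁ app b ≫ eqToHom (τ.naturality f) = eqToHom (σ.naturality f) ≫ app a ▷ G.map f

@[ext] lemma TwoNat.ext_app {F G : StrictPseudofunctor A D} {σ τ : TwoNat F G}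
    (h : ∀ a, σ.app a = τ.app a) : σ = τ := by
  obtain ⟨σ, _, _⟩ := σ
  obtain ⟨τ, _, _⟩ := τ
  obtain rfl : σ = τ := funext h
  rfl

variable (A D) in
/-- The type of 2-functors from `A` to `D`, as the objects of the 2-category `Hom(A, D)`. -/
structure TwoHom where
  fun₂ : StrictPseudofunctor A D

variable [Strict D]

lemma eqToHom_square_comp {x y z x' y' z' : D} {f : x ⟶ x'} {g : y ⟶ y'} {h : z ⟶ z'}
    {s : x ⟶ y} {s' : x' ⟶ y'} {t : y ⟶ z} {t' : y' ⟶ z'} (e : f ≫ s' = s ≫ g)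
    (e' : g ≫ t' = t ≫ h) (e'' : f ≫ s' ≫ t' = (s ≫ t) ≫ h) :
    eqToHom e'' = (α_ _ _ _).inv ≫ eqToHom e ▷ t' ≫ (α_ _ _ _).hom ≫ s ◁ eqToHom e' ≫
      (α_ _ _ _).inv := by
  simp [Strict.associator_eqToIso]

instance : CategoryStruct (TwoHom A D) where
  Hom F G := TwoNat F.fun₂ G.fun₂
  id F :=
    { app := fun a => 𝟙 _
      naturality := fun f => by rw [Strict.id_comp, Strict.comp_id]
      naturality₂ := fun η => by
        simp [Strict.leftUnitor_eqToIso, Strict.rightUnitor_eqToIso] }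
  comp {F G H} σ τ :=
    { app := fun a => σ.app a ≫ τ.app a
      naturality := fun f => by
        rw [← Strict.assoc, σ.naturality, Strict.assoc, τ.naturality, Strict.assoc]
      naturality₂ := fun {a b f g} η => by
        have h₁ := σ.naturality₂ η
        have h₂ := τ.naturality₂ η
        rw [eqToHom_square_comp (σ.naturality f) (τ.naturality f),
          eqToHom_square_comp (σ.naturality g) (τ.naturality g)]
        have h₁' : F.fun₂.map₂ η ▷ σ.app b ▷ τ.app b ≫ eqToHom (σ.naturality g) ▷ τ.app b =
            eqToHom (σ.naturality f) ▷ τ.app b ≫ (σ.app a ◁ G.fun₂.map₂ η) ▷ τ.app b := by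
          rw [← comp_whiskerRight, h₁, comp_whiskerRight]
        have h₂' : σ.app a ◁ G.fun₂.map₂ η ▷ τ.app b ≫ σ.app a ◁ eqToHom (τ.naturality g) =
            σ.app a ◁ eqToHom (τ.naturality f) ≫ σ.app a ◁ τ.app a ◁ H.fun₂.map₂ η := by
          rw [← whiskerLeft_comp, h₂, whiskerLeft_comp]
        rw [whiskerRight_comp]
        simp only [Category.assoc, Iso.hom_inv_id_assoc]
        rw [reassoc_of% h₁', whisker_assoc]
        simp only [Category.assoc, Iso.inv_hom_id_assoc]
        rw [reassoc_of% h₂', comp_whiskerLeft]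
        simp }

instance (F G : TwoHom A D) : Category (F ⟶ G) where
  Hom σ τ := TwoNat.Modif σ τ
  id σ := { app := fun a => 𝟙 _, naturality := by simp }
  comp m n :=
    { app := fun a => m.app a ≫ n.app a
      naturality := fun f => by
        rw [whiskerLeft_comp, Category.assoc, n.naturality, reassoc_of% m.naturality]
        simp }
  id_comp m := TwoNat.Modif.ext (funext fun a => Category.id_comp _)
  comp_id m := TwoNat.Modif.ext (funext fun a => Category.comp_id _)
  assoc m n o := TwoNat.Modif.ext (funext fun a => Category.assoc _ _ _)

variable {F G H : TwoHom A D}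

@[simp] lemma TwoHom.id_app (a : A) : TwoNat.app (𝟙 F) a = 𝟙 _ := rfl
@[simp] lemma TwoHom.comp_app (σ : F ⟶ G) (τ : G ⟶ H) (a : A) :
    TwoNat.app (σ ≫ τ) a = σ.app a ≫ τ.app a := rfl
@[simp] lemma TwoHom.id₂_app (σ : F ⟶ G) (a : A) : TwoNat.Modif.app (𝟙 σ) a = 𝟙 _ := rfl
@[simp] lemma TwoHom.comp₂_app {σ τ ρ : F ⟶ G} (m : σ ⟶ τ) (n : τ ⟶ ρ) (a : A) :
    TwoNat.Modif.app (m ≫ n) a = m.app a ≫ n.app a := rfl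

@[ext] lemma TwoHom.hom₂_ext {σ τ : F ⟶ G} {m n : σ ⟶ τ} (h : ∀ a, m.app a = n.app a) : m = n :=
  TwoNat.Modif.ext (funext h)

@[simp] lemma TwoHom.eqToHom_app {σ τ : F ⟶ G} (h : σ = τ) (a : A) :
    TwoNat.Modif.app (eqToHom h) a = eqToHom (by rw [h]) := by
  subst h; rfl

def TwoHom.isoMk {σ τ : F ⟶ G} (m : ∀ a, σ.app a ≅ τ.app a)
    (h : ∀ {a b : A} (f : a ⟶ b), F.fun₂.map f ◁ (m b).hom ≫ eqToHom (τ.naturality f) =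
      eqToHom (σ.naturality f) ≫ (m a).hom ▷ G.fun₂.map f) : σ ≅ τ where
  hom := { app := fun a => (m a).hom, naturality := h }
  inv :=
    { app := fun a => (m a).inv
      naturality := fun {a b} f => by
        rw [← cancel_epi (F.fun₂.map f ◁ (m b).hom), reassoc_of% h f]
        simp }

def TwoHom.isoMkOfEq {σ τ : F ⟶ G} (m : ∀ a, σ.app a ≅ τ.app a) (e : ∀ a, σ.app a = τ.app a)
    (h : ∀ a, m a = eqToIso (e a)) : σ ≅ τ :=
  TwoHom.isoMk m fun {a b} f => by rw [h a, h b]; simp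

/-- Whiskering of a modification on the left. -/
def TwoHom.whiskerLeft (σ : F ⟶ G) {τ ρ : G ⟶ H} (m : τ ⟶ ρ) : TwoNat.Modif (σ ≫ τ) (σ ≫ ρ) where
  app a := σ.app a ◁ m.app a
  naturality {a b} f := by
    have h : σ.app a ◁ G.fun₂.map f ◁ m.app b ≫ σ.app a ◁ eqToHom (ρ.naturality f) =
        σ.app a ◁ eqToHom (τ.naturality f) ≫ σ.app a ◁ m.app a ▷ H.fun₂.map f := by
      rw [← whiskerLeft_comp, m.naturality, whiskerLeft_comp]
    rw [eqToHom_square_comp (σ.naturality f) (τ.naturality f) ((σ ≫ τ).naturality f),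
      eqToHom_square_comp (σ.naturality f) (ρ.naturality f) ((σ ≫ ρ).naturality f)]
    dsimp only [TwoHom.comp_app]
    rw [associator_inv_naturality_right_assoc, whisker_exchange_assoc]
    simp only [comp_whiskerLeft, Category.assoc, Iso.inv_hom_id_assoc]
    rw [reassoc_of% h]
    simp

/-- Whiskering of a modification on the right. -/
def TwoHom.whiskerRight {σ τ : F ⟶ G} (m : σ ⟶ τ) (ρ : G ⟶ H) : TwoNat.Modif (σ ≫ ρ) (τ ≫ ρ) where
  app a := m.app a ▷ ρ.app a
  naturality {a b} f := by
    have h : (F.fun₂.map f ◁ m.app b) ▷ ρ.app b ≫ eqToHom (τ.naturality f) ▷ ρ.app b =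
        eqToHom (σ.naturality f) ▷ ρ.app b ≫ (m.app a ▷ G.fun₂.map f) ▷ ρ.app b := by
      rw [← comp_whiskerRight, m.naturality, comp_whiskerRight]
    rw [eqToHom_square_comp (σ.naturality f) (ρ.naturality f) ((σ ≫ ρ).naturality f),
      eqToHom_square_comp (τ.naturality f) (ρ.naturality f) ((τ ≫ ρ).naturality f)]
    dsimp only [TwoHom.comp_app]
    rw [associator_inv_naturality_middle_assoc, reassoc_of% h, associator_naturality_left_assoc, ←
      whisker_exchange_assoc]
    simp

instance : Bicategory (TwoHom A D) where
  whiskerLeft σ _ _ m := TwoHom.whiskerLeft σ m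
  whiskerRight m ρ := TwoHom.whiskerRight m ρ
  associator σ τ ρ := TwoHom.isoMkOfEq (fun a => α_ (σ.app a) (τ.app a) (ρ.app a)) _
    fun _ => Strict.associator_eqToIso _ _ _
  leftUnitor σ := TwoHom.isoMkOfEq (fun a => λ_ (σ.app a)) _
    fun _ => Strict.leftUnitor_eqToIso _
  rightUnitor σ := TwoHom.isoMkOfEq (fun a => ρ_ (σ.app a)) _
    fun _ => Strict.rightUnitor_eqToIso _
  whiskerLeft_id _ _ := TwoHom.hom₂_ext fun a => whiskerLeft_id _ _
  whiskerLeft_comp _ _ _ _ _ _ := TwoHom.hom₂_ext fun a => whiskerLeft_comp _ _ _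
  id_whiskerLeft _ := TwoHom.hom₂_ext fun a => id_whiskerLeft _
  comp_whiskerLeft _ _ _ _ _ := TwoHom.hom₂_ext fun a => comp_whiskerLeft _ _ _
  id_whiskerRight _ _ := TwoHom.hom₂_ext fun a => id_whiskerRight _ _
  comp_whiskerRight _ _ _ := TwoHom.hom₂_ext fun a => comp_whiskerRight _ _ _
  whiskerRight_id _ := TwoHom.hom₂_ext fun a => whiskerRight_id _
  whiskerRight_comp _ _ _ := TwoHom.hom₂_ext fun a => whiskerRight_comp _ _ _
  whisker_assoc _ _ _ _ _ := TwoHom.hom₂_ext fun a => whisker_assoc _ _ _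
  whisker_exchange _ _ := TwoHom.hom₂_ext fun a => whisker_exchange _ _
  pentagon _ _ _ _ := TwoHom.hom₂_ext fun a => pentagon _ _ _ _
  triangle _ _ := TwoHom.hom₂_ext fun a => triangle _ _

instance : Strict (TwoHom A D) where
  id_comp σ := TwoNat.ext_app fun a => Strict.id_comp _
  comp_id σ := TwoNat.ext_app fun a => Strict.comp_id _
  assoc σ τ ρ := TwoNat.ext_app fun a => Strict.assoc _ _ _
  leftUnitor_eqToIso σ := by
    ext a
    change (λ_ (σ.app a)).hom = _
    simp [Strict.leftUnitor_eqToIso]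
  rightUnitor_eqToIso σ := by
    ext a
    change (ρ_ (σ.app a)).hom = _
    simp [Strict.rightUnitor_eqToIso]
  associator_eqToIso σ τ ρ := by
    ext a
    change (α_ (σ.app a) (τ.app a) (ρ.app a)).hom = _
    simp [Strict.associator_eqToIso]

end TwoFunctors

section Representables

variable {C : Type u} [Bicategory.{v, v} C] [Strict C]

section Strictness
variable {A A' B B' B'' : C}

lemma whiskerLeft_whiskerLeft_eq (r : A ⟶ B) (g : B ⟶ B') {h h' : B' ⟶ B''} (η : h ⟶ h') :
    r ◁ g ◁ η = eqToHom (Strict.assoc r g h).symm ≫ (r ≫ g) ◁ η ≫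
      eqToHom (Strict.assoc r g h') := by
  simp [Strict.associator_eqToIso]

lemma whiskerLeft_whiskerRight_eq (r : A ⟶ B) {g g' : B ⟶ B'} (η : g ⟶ g') (h : B' ⟶ B'') :
    r ◁ η ▷ h = eqToHom (Strict.assoc r g h).symm ≫ (r ◁ η) ▷ h ≫
      eqToHom (Strict.assoc r g' h) := by
  simp [Strict.associator_eqToIso]

lemma whiskerRight_whiskerRight_eq {r r' : A ⟶ B} (θ : r ⟶ r') (g : B ⟶ B') (h : B' ⟶ B'') :
    θ ▷ (g ≫ h) = eqToHom (Strict.assoc r g h).symm ≫ θ ▷ g ▷ h ≫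
      eqToHom (Strict.assoc r' g h) := by
  simp [Strict.associator_eqToIso]

lemma whiskerLeft_whiskerLeft_square (r : A ⟶ B) (g : B ⟶ B') {h h' : B' ⟶ B''} (η : h ⟶ h') :
    r ◁ g ◁ η ≫ eqToHom (Strict.assoc r g h').symm =
      eqToHom (Strict.assoc r g h).symm ≫ (r ≫ g) ◁ η := by
  simp [Strict.associator_eqToIso]

lemma whiskerRight_whiskerRight_square {r r' : A ⟶ B} (θ : r ⟶ r') (g : B ⟶ B') (h : B' ⟶ B'') :
    θ ▷ (g ≫ h) ≫ eqToHom (Strict.assoc r' g h).symm =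
      eqToHom (Strict.assoc r g h).symm ≫ θ ▷ g ▷ h := by
  simp [Strict.associator_eqToIso]

lemma whisker_assoc_eq (r : A ⟶ B) {g g' : B ⟶ B'} (θ : g ⟶ g') (h : B' ⟶ B'') :
    (r ◁ θ) ▷ h = eqToHom (Strict.assoc r g h) ≫ r ◁ θ ▷ h ≫
      eqToHom (Strict.assoc r g' h).symm := by
  simp [Strict.associator_eqToIso]

lemma whiskerRight_comp_eq {r r' : A ⟶ B} (θ : r ⟶ r') (g : B ⟶ B') (h : B' ⟶ B'') :
    θ ▷ g ▷ h = eqToHom (Strict.assoc r g h) ≫ θ ▷ (g ≫ h) ≫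
      eqToHom (Strict.assoc r' g h).symm := by
  simp [Strict.associator_eqToIso]

end Strictness

/-- The functor `- ≫ g : C(A, B) ⥤ C(A, B')`. -/
def postFunctor (A : C) {B B' : C} (g : B ⟶ B') : (A ⟶ B) ⥤ (A ⟶ B') where
  obj r := r ≫ g
  map θ := θ ▷ g

/-- The functor `r ≫ - : C(A', B) ⥤ C(A, B)`. -/
def preFunctor {A A' : C} (r : A ⟶ A') (B : C) : (A' ⟶ B) ⥤ (A ⟶ B) where
  obj s := r ≫ s
  map θ := r ◁ θ

lemma postFunctor_id (A B : C) : postFunctor A (𝟙 B) = 𝟭 _ :=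
  CategoryTheory.Functor.ext (fun r => Strict.comp_id r) fun r s θ => by
    change θ ▷ 𝟙 B = eqToHom _ ≫ θ ≫ eqToHom _
    simp [Strict.rightUnitor_eqToIso]

lemma postFunctor_comp (A : C) {B B' B'' : C} (g : B ⟶ B') (g' : B' ⟶ B'') :
    postFunctor A (g ≫ g') = postFunctor A g ⋙ postFunctor A g' :=
  CategoryTheory.Functor.ext (fun r => (Strict.assoc r g g').symm) fun r s θ => by
    change θ ▷ (g ≫ g') = eqToHom _ ≫ θ ▷ g ▷ g' ≫ eqToHom _
    simp [Strict.associator_eqToIso]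

lemma preFunctor_postFunctor {A A' B B' : C} (r : A ⟶ A') (g : B ⟶ B') :
    postFunctor A' g ⋙ preFunctor r B' = preFunctor r B ⋙ postFunctor A g :=
  CategoryTheory.Functor.ext (fun s => (Strict.assoc r s g).symm) fun s s' θ => by
    exact whiskerLeft_whiskerRight_eq r θ g

lemma preFunctor_id (A B : C) : preFunctor (𝟙 A) B = 𝟭 _ :=
  CategoryTheory.Functor.ext (fun r => Strict.id_comp r) fun r s θ => by
    change 𝟙 A ◁ θ = eqToHom _ ≫ θ ≫ eqToHom _
    simp [Strict.leftUnitor_eqToIso]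

lemma preFunctor_comp {A A' A'' : C} (r : A ⟶ A') (s : A' ⟶ A'') (B : C) :
    preFunctor (r ≫ s) B = preFunctor s B ⋙ preFunctor r B :=
  CategoryTheory.Functor.ext (fun t => Strict.assoc r s t) fun t t' θ => by
    change (r ≫ s) ◁ θ = eqToHom _ ≫ r ◁ s ◁ θ ≫ eqToHom _
    simp [Strict.associator_eqToIso]

/-- The representable 2-functor `C(A, -)`. -/
def reprTwo (A : C) : StrictPseudofunctor C Cat.{v, v} :=
  StrictPseudofunctor.mk''
    { obj B := Cat.of (A ⟶ B)
      map g := (postFunctor A g).toCatHom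
      map₂ {B B'} g g' γ := NatTrans.toCatHom₂
        { app (r : A ⟶ B) := r ◁ γ
          naturality r s θ := (whisker_exchange θ γ).symm }
      map₂_id {B B'} g := by
        ext r
        exact whiskerLeft_id r g
      map₂_comp {B B'} g g' g'' γ γ' := by
        ext r
        exact whiskerLeft_comp r γ γ'
      map_id B := congrArg Functor.toCatHom (postFunctor_id A B)
      map_comp g g' := congrArg Functor.toCatHom (postFunctor_comp A g g')
      map₂_whisker_left {B B' B''} g h h' η := by
        ext r
        simp only [Cat.Hom₂.comp_app, Cat.eqToHom_app]
        exact whiskerLeft_whiskerLeft_eq r g η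
      map₂_whisker_right {B B' B''} g g' η h := by
        ext r
        simp only [Cat.Hom₂.comp_app, Cat.eqToHom_app]
        exact whiskerLeft_whiskerRight_eq r η h }

/-- Precomposition with `r : A ⟶ A'`, as a 2-natural transformation `C(A', -) ⟶ C(A, -)`. -/
def reprMap {A A' : C} (r : A ⟶ A') : TwoNat (reprTwo A') (reprTwo A) where
  app B := (preFunctor r B).toCatHom
  naturality g := congrArg Functor.toCatHom (preFunctor_postFunctor r g)
  naturality₂ {B B'} g g' γ := by
    ext s
    simp only [Cat.Hom₂.comp_app]
    erw [Cat.eqToHom_app, Cat.eqToHom_app]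
    exact whiskerLeft_whiskerLeft_square r s γ

/-- The modification induced by a 2-cell `θ : r ⟶ s`. -/
def reprMap₂ {A A' : C} {r s : A ⟶ A'} (θ : r ⟶ s) : (reprMap r).Modif (reprMap s) where
  app B := NatTrans.toCatHom₂
    { app (t : A' ⟶ B) := θ ▷ t
      naturality t t' η := (whisker_exchange θ η) }
  naturality {B B'} f := by
    ext t
    simp only [Cat.Hom₂.comp_app]
    erw [Cat.eqToHom_app, Cat.eqToHom_app]
    exact whiskerRight_whiskerRight_square θ t f

lemma op2_eqToHom {B : Type u} [Bicategory.{w, v} B] {a b : B} {f g : a ⟶ b} (h : f = g) :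
    op2 (eqToHom h) = eqToHom (congrArg Quiver.Hom.op h) := by
  subst h; rfl

instance strictOp {B : Type u} [Bicategory.{w, v} B] [Strict B] : Strict Bᵒᵖ where
  id_comp f := congrArg Quiver.Hom.op (Strict.comp_id f.unop)
  comp_id f := congrArg Quiver.Hom.op (Strict.id_comp f.unop)
  assoc f g h := congrArg Quiver.Hom.op (Strict.assoc h.unop g.unop f.unop).symm
  leftUnitor_eqToIso {a b} f := by
    apply Iso.ext
    refine (congrArg (fun e => op2 e.hom) (Strict.rightUnitor_eqToIso f.unop)).trans ?_
    exact op2_eqToHom (Strict.comp_id f.unop)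
  rightUnitor_eqToIso f := by
    apply Iso.ext
    refine (congrArg (fun e => op2 e.hom) (Strict.leftUnitor_eqToIso f.unop)).trans ?_
    exact op2_eqToHom (Strict.id_comp f.unop)
  associator_eqToIso f g h := by
    apply Iso.ext
    refine (congrArg (fun e => op2 e.inv)
      (Strict.associator_eqToIso h.unop g.unop f.unop)).trans ?_
    exact op2_eqToHom ((Strict.assoc h.unop g.unop f.unop).symm)

section
variable {A A' A'' : C}

/-- `reprMap` as a 1-cell of `Hom(C, Cat)`. -/
def yoMap (r : A ⟶ A') : TwoHom.mk (reprTwo A') ⟶ TwoHom.mk (reprTwo A) := reprMap r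

/-- `reprMap₂` as a 2-cell of `Hom(C, Cat)`. -/
def yoMap₂ {r s : A ⟶ A'} (θ : r ⟶ s) : yoMap r ⟶ yoMap s := reprMap₂ θ

lemma yoMap_id (A : C) : yoMap (𝟙 A) = 𝟙 _ :=
  TwoNat.ext_app fun B => congrArg Functor.toCatHom (preFunctor_id A B)

lemma yoMap_comp (r : A ⟶ A') (s : A' ⟶ A'') : yoMap (r ≫ s) = yoMap s ≫ yoMap r :=
  TwoNat.ext_app fun B => congrArg Functor.toCatHom (preFunctor_comp r s B)

lemma yoMap₂_id (r : A ⟶ A') : yoMap₂ (𝟙 r) = 𝟙 _ := by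
  refine TwoHom.hom₂_ext fun B => ?_
  ext t
  exact id_whiskerRight r t

lemma yoMap₂_comp {r s t : A ⟶ A'} (θ : r ⟶ s) (θ' : s ⟶ t) :
    yoMap₂ (θ ≫ θ') = yoMap₂ θ ≫ yoMap₂ θ' := by
  refine TwoHom.hom₂_ext fun B => ?_
  ext x
  exact comp_whiskerRight θ θ' x

lemma yoMap₂_whiskerLeft (r : A ⟶ A') {s s' : A' ⟶ A''} (θ : s ⟶ s') :
    yoMap₂ (r ◁ θ) = eqToHom (yoMap_comp r s) ≫ yoMap₂ θ ▷ yoMap r ≫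
      eqToHom (yoMap_comp r s').symm := by
  refine TwoHom.hom₂_ext fun B => ?_
  simp only [TwoHom.comp₂_app, TwoHom.eqToHom_app]
  ext x
  simp only [Cat.Hom₂.comp_app]
  erw [Cat.eqToHom_app, Cat.eqToHom_app]
  exact whisker_assoc_eq r θ x

lemma yoMap₂_whiskerRight {r r' : A ⟶ A'} (θ : r ⟶ r') (s : A' ⟶ A'') :
    yoMap₂ (θ ▷ s) = eqToHom (yoMap_comp r s) ≫ yoMap s ◁ yoMap₂ θ ≫
      eqToHom (yoMap_comp r' s).symm := by
  refine TwoHom.hom₂_ext fun B => ?_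
  simp only [TwoHom.comp₂_app, TwoHom.eqToHom_app]
  ext x
  simp only [Cat.Hom₂.comp_app]
  erw [Cat.eqToHom_app, Cat.eqToHom_app]
  exact whiskerRight_comp_eq θ s x

end

variable (C) in
/-- The embedding of `C` in `Hom(C, Cat)ᵒᵖ`, `A ↦ C(A, -)`. -/
def yonedaTwo : StrictPseudofunctor C (TwoHom C Cat.{v, v})ᵒᵖ :=
  StrictPseudofunctor.mk''
    { obj A := op ⟨reprTwo A⟩
      map r := (yoMap r).op
      map₂ θ := op2 (yoMap₂ θ)
      map₂_id r := congrArg op2 (yoMap₂_id r)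
      map₂_comp θ θ' := congrArg op2 (yoMap₂_comp θ θ')
      map_id A := congrArg Quiver.Hom.op (yoMap_id A)
      map_comp r s := congrArg Quiver.Hom.op (yoMap_comp r s)
      map₂_whisker_left r s s' θ := by
        rw [← op2_eqToHom (yoMap_comp r s), ← op2_eqToHom (yoMap_comp r s').symm]
        exact congrArg op2 (yoMap₂_whiskerLeft r θ)
      map₂_whisker_right {_ _ _ r r'} θ s := by
        rw [← op2_eqToHom (yoMap_comp r s), ← op2_eqToHom (yoMap_comp r' s).symm]
        exact congrArg op2 (yoMap₂_whiskerRight θ s) }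

end Representables

namespace KCat

section Pasting

variable {J : Type u₁} [Bicategory.{w₁, v₁} J] {C : Type u} [Bicategory.{w, v} C]
  {P : Type u₂} [Bicategory.{w₂, v₂} P] {Y : Jᵒᵖ ⥤ᵖ P} {c : C ⥤ᵖ P}
  {j₀ j₁ j₂ j₃ : J} {B₀ B₁ B₂ B₃ : C} {p₀ : Y.obj (op j₀) ⟶ c.obj B₀}
  {p₁ : Y.obj (op j₁) ⟶ c.obj B₁} {p₂ : Y.obj (op j₂) ⟶ c.obj B₂}
  {p₃ : Y.obj (op j₃) ⟶ c.obj B₃}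

/-- The pasting `r φ' ∘ φ Y^{a'}`. -/
def paste {a : j₀ ⟶ j₁} {a' : j₁ ⟶ j₂} {r : B₁ ⟶ B₀} {r' : B₂ ⟶ B₁}
    (φ : Y.map a.op ≫ p₀ ≅ p₁ ≫ c.map r) (φ' : Y.map a'.op ≫ p₁ ≅ p₂ ≫ c.map r') :
    Y.map (a ≫ a').op ≫ p₀ ≅ p₂ ≫ c.map (r' ≫ r) :=
  whiskerRightIso (Y.mapComp a'.op a.op) p₀ ≪≫ α_ _ _ _ ≪≫
    whiskerLeftIso (Y.map a'.op) φ ≪≫ (α_ _ _ _).symm ≪≫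
    whiskerRightIso φ' (c.map r) ≪≫ α_ _ _ _ ≪≫ whiskerLeftIso p₂ (c.mapComp r' r).symm

/-- The identity pasting. -/
def pasteId (p₀ : Y.obj (op j₀) ⟶ c.obj B₀) : Y.map (𝟙 j₀).op ≫ p₀ ≅ p₀ ≫ c.map (𝟙 B₀) :=
  whiskerRightIso (Y.mapId (op j₀)) p₀ ≪≫ λ_ p₀ ≪≫ (ρ_ p₀).symm ≪≫
    whiskerLeftIso p₀ (c.mapId B₀).symm

lemma paste_left {a : j₀ ⟶ j₁} {a' b' : j₁ ⟶ j₂} {r : B₁ ⟶ B₀} {r' s' : B₂ ⟶ B₁}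
    (φ : Y.map a.op ≫ p₀ ≅ p₁ ≫ c.map r) (φ' : Y.map a'.op ≫ p₁ ≅ p₂ ≫ c.map r')
    (ψ' : Y.map b'.op ≫ p₁ ≅ p₂ ≫ c.map s') (α : a' ⟶ b') (θ : r' ⟶ s')
    (h : φ'.hom ≫ p₂ ◁ c.map₂ θ = Y.map₂ (op2 α) ▷ p₁ ≫ ψ'.hom) :
    (paste φ φ').hom ≫ p₂ ◁ c.map₂ (θ ▷ r) =
      Y.map₂ (op2 (a ◁ α)) ▷ p₀ ≫ (paste φ ψ').hom := by
  have h' : φ'.hom ▷ c.map r ≫ (α_ _ _ _).hom ≫ p₂ ◁ c.map₂ θ ▷ c.map r =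
      Y.map₂ (op2 α) ▷ p₁ ▷ c.map r ≫ ψ'.hom ▷ c.map r ≫ (α_ _ _ _).hom := by
    have := congr($h ▷ c.map r)
    simp only [comp_whiskerRight, whisker_assoc] at this
    rw [← cancel_mono (α_ _ _ _).inv]
    simpa using this
  have e : Y.map a'.op ◁ φ.hom ≫ (α_ _ _ _).inv ≫ Y.map₂ (op2 α) ▷ p₁ ▷ c.map r =
      (α_ _ _ _).inv ≫ Y.map₂ (op2 α) ▷ Y.map a.op ▷ p₀ ≫ (α_ _ _ _).hom ≫
        Y.map b'.op ◁ φ.hom ≫ (α_ _ _ _).inv := by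
    have := whisker_exchange (Y.map₂ (op2 α)) φ.hom
    simp only [whiskerRight_comp, Category.assoc] at this
    rw [← cancel_mono (α_ _ _ _).hom]
    simpa using this
  simp only [paste, Iso.trans_hom, whiskerRightIso_hom, whiskerLeftIso_hom, Iso.symm_hom,
    Category.assoc]
  simp
  rw [reassoc_of% h', reassoc_of% e]
  simp

lemma paste_right {a b : j₀ ⟶ j₁} {a' : j₁ ⟶ j₂} {r s : B₁ ⟶ B₀} {r' : B₂ ⟶ B₁}
    (φ : Y.map a.op ≫ p₀ ≅ p₁ ≫ c.map r) (ψ : Y.map b.op ≫ p₀ ≅ p₁ ≫ c.map s)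
    (φ' : Y.map a'.op ≫ p₁ ≅ p₂ ≫ c.map r') (α : a ⟶ b) (θ : r ⟶ s)
    (h : φ.hom ≫ p₁ ◁ c.map₂ θ = Y.map₂ (op2 α) ▷ p₀ ≫ ψ.hom) :
    (paste φ φ').hom ≫ p₂ ◁ c.map₂ (r' ◁ θ) =
      Y.map₂ (op2 (α ▷ a')) ▷ p₀ ≫ (paste ψ φ').hom := by
  have h' : Y.map a'.op ◁ φ.hom ≫ Y.map a'.op ◁ p₁ ◁ c.map₂ θ =
      Y.map a'.op ◁ Y.map₂ (op2 α) ▷ p₀ ≫ Y.map a'.op ◁ ψ.hom := by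
    rw [← whiskerLeft_comp, h, whiskerLeft_comp]
  have e : φ'.hom ▷ c.map r ≫ (α_ _ _ _).hom ≫ p₂ ◁ c.map r' ◁ c.map₂ θ =
      (α_ _ _ _).hom ≫ Y.map a'.op ◁ p₁ ◁ c.map₂ θ ≫ (α_ _ _ _).inv ≫
        φ'.hom ▷ c.map s ≫ (α_ _ _ _).hom := by
    have := whisker_exchange φ'.hom (c.map₂ θ)
    simp only [comp_whiskerLeft, Category.assoc] at this
    rw [← cancel_mono (α_ _ _ _).inv]
    simpa using this.symm
  simp [paste]
  rw [reassoc_of% e]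
  simp
  rw [reassoc_of% h']

lemma paste_assoc {a : j₀ ⟶ j₁} {a' : j₁ ⟶ j₂} {a'' : j₂ ⟶ j₃} {r : B₁ ⟶ B₀} {r' : B₂ ⟶ B₁}
    {r'' : B₃ ⟶ B₂} (φ : Y.map a.op ≫ p₀ ≅ p₁ ≫ c.map r)
    (φ' : Y.map a'.op ≫ p₁ ≅ p₂ ≫ c.map r') (φ'' : Y.map a''.op ≫ p₂ ≅ p₃ ≫ c.map r'') :
    (paste (paste φ φ') φ'').hom ≫ p₃ ◁ c.map₂ (α_ r'' r' r).inv =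
      Y.map₂ (op2 (α_ a a' a'').hom) ▷ p₀ ≫ (paste φ (paste φ' φ'')).hom := by
  have hY : (Y.mapComp a''.op (a'.op ≫ a.op)).hom ▷ p₀ ≫ (α_ _ _ _).hom ≫
      Y.map a''.op ◁ (Y.mapComp a'.op a.op).hom ▷ p₀ =
      Y.map₂ (α_ a''.op a'.op a.op).inv ▷ p₀ ≫ (Y.mapComp (a''.op ≫ a'.op) a.op).hom ▷ p₀ ≫
        (Y.mapComp a''.op a'.op).hom ▷ Y.map a.op ▷ p₀ ≫ (α_ _ _ _).hom ▷ p₀ ≫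
          (α_ _ _ _).hom := by
    have := congr($(Y.mapComp_assoc_right_hom a''.op a'.op a.op) ▷ p₀)
    simp only [comp_whiskerRight, whisker_assoc] at this
    rw [← cancel_mono (α_ _ _ _).inv]
    simpa using this
  have hC : p₃ ◁ (c.mapComp r'' r').inv ▷ c.map r ≫ p₃ ◁ (c.mapComp (r'' ≫ r') r).inv =
      p₃ ◁ (α_ _ _ _).hom ≫ p₃ ◁ c.map r'' ◁ (c.mapComp r' r).inv ≫
        p₃ ◁ (c.mapComp r'' (r' ≫ r)).inv ≫ p₃ ◁ c.map₂ (α_ r'' r' r).inv := by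
    simp only [← whiskerLeft_comp, c.mapComp_assoc_left_inv]
  have e₁ : Y.map (a''.op ≫ a'.op) ◁ φ.hom ≫ (α_ _ _ _).inv ≫
      (Y.mapComp a''.op a'.op).hom ▷ p₁ ▷ c.map r =
      (α_ _ _ _).inv ≫ (Y.mapComp a''.op a'.op).hom ▷ Y.map a.op ▷ p₀ ≫ (α_ _ _ _).hom ≫
        (Y.map a''.op ≫ Y.map a'.op) ◁ φ.hom ≫ (α_ _ _ _).inv := by
    have := whisker_exchange (Y.mapComp a''.op a'.op).hom φ.hom
    simp only [whiskerRight_comp, Category.assoc] at this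
    rw [← cancel_mono (α_ _ _ _).hom]
    simpa using this
  have e₂ : Y.map a''.op ◁ p₂ ◁ (c.mapComp r' r).inv ≫ (α_ _ _ _).inv ≫
      φ''.hom ▷ c.map (r' ≫ r) = (α_ _ _ _).inv ≫ φ''.hom ▷ (c.map r' ≫ c.map r) ≫
        (α_ _ _ _).hom ≫ p₃ ◁ c.map r'' ◁ (c.mapComp r' r).inv ≫ (α_ _ _ _).inv := by
    have := whisker_exchange φ''.hom (c.mapComp r' r).inv
    simp only [comp_whiskerLeft, Category.assoc] at this
    rw [← cancel_epi (α_ _ _ _).hom]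
    simpa using this
  simp [paste]
  rw [reassoc_of% hY, reassoc_of% e₁, hC, reassoc_of% e₂]
  simp

lemma paste_id_left {a : j₀ ⟶ j₁} {r : B₁ ⟶ B₀} (φ : Y.map a.op ≫ p₀ ≅ p₁ ≫ c.map r) :
    (paste (pasteId p₀) φ).hom ≫ p₁ ◁ c.map₂ (ρ_ r).hom =
      Y.map₂ (op2 (λ_ a).hom) ▷ p₀ ≫ φ.hom := by
  have e : (ρ_ (Y.map a.op ≫ p₀)).inv ≫ (α_ _ _ _).hom ≫ Y.map a.op ◁ p₀ ◁ (c.mapId B₀).inv ≫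
      (α_ _ _ _).inv ≫ φ.hom ▷ c.map (𝟙 B₀) =
      φ.hom ≫ (ρ_ _).inv ≫ (α_ _ _ _).hom ≫ p₁ ◁ c.map r ◁ (c.mapId B₀).inv ≫
        (α_ _ _ _).inv := by
    have := whisker_exchange φ.hom (c.mapId B₀).inv
    simp only [comp_whiskerLeft, Category.assoc, whiskerRight_id] at this
    simpa using congr((ρ_ _).inv ≫ $this)
  simp [paste, pasteId]
  rw [reassoc_of% e]
  simp

lemma paste_id_right {a : j₀ ⟶ j₁} {r : B₁ ⟶ B₀} (φ : Y.map a.op ≫ p₀ ≅ p₁ ≫ c.map r) :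
    (paste φ (pasteId p₁)).hom ≫ p₁ ◁ c.map₂ (λ_ r).hom =
      Y.map₂ (op2 (ρ_ a).hom) ▷ p₀ ≫ φ.hom := by
  have e : Y.map (𝟙 (op j₁)) ◁ φ.hom ≫ (α_ _ _ _).inv ≫ (Y.mapId (op j₁)).hom ▷ p₁ ▷ c.map r =
      (α_ _ _ _).inv ≫ (Y.mapId (op j₁)).hom ▷ Y.map a.op ▷ p₀ ≫ (α_ _ _ _).hom ≫
        (λ_ _).hom ≫ φ.hom ≫ (λ_ _).inv ≫ (α_ _ _ _).inv := by
    have := whisker_exchange (Y.mapId (op j₁)).hom φ.hom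
    simp only [whiskerRight_comp, Category.assoc, id_whiskerLeft] at this
    rw [← cancel_mono (α_ _ _ _).hom]
    simpa using this
  simp [paste, pasteId]
  rw [reassoc_of% e]
  simp

end Pasting
end KCat

/-!
The index 2-category. The data are a diagram `Y : Jᵒᵖ ⥤ P`, an embedding `c : C ⥤ P` and, for
every `j`, a family of 1-cells `π^j_i : Y^j ⟶ c(Y^j_i)` with `Y^j_i` in `C`.
-/

namespace KCat

variable {J : Type u₁} [Bicategory.{w₁, v₁} J] {C : Type u} [Bicategory.{w, v} C]
  {P : Type u₂} [Bicategory.{w₂, v₂} P] {Y : Jᵒᵖ ⥤ᵖ P} {c : C ⥤ᵖ P} {Idx : J → Type u₃}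
  {ob : ∀ j, Idx j → C}

/-- 0-cells: pairs `(i, j)`, with `j : J` and `i` in the index of `Y_j`. -/
@[ext] structure Ob (π : ∀ j (i : Idx j), Y.obj (op j) ⟶ c.obj (ob j i)) where
  j : J
  i : Idx j

variable {π : ∀ j (i : Idx j), Y.obj (op j) ⟶ c.obj (ob j i)}

/-- The object `Y^j_i` of `C`. -/
abbrev Ob.val (x : Ob π) : C := ob x.j x.i

/-- The projection `π^j_i : Y^j ⟶ Y^j_i`. -/
abbrev Ob.pr (x : Ob π) : Y.obj (op x.j) ⟶ c.obj x.val := π x.j x.i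

/-- 1-cells `(i, j) ⟶ (i', j')`: triples `(a, r, φ)` with `a : j ⟶ j'`,
`r : Y^{j'}_{i'} ⟶ Y^j_i` and `φ` exhibiting that `r` represents `Y^a`. -/
structure Hom (x y : Ob π) where
  a : x.j ⟶ y.j
  r : y.val ⟶ x.val
  φ : Y.map a.op ≫ x.pr ≅ y.pr ≫ c.map r

/-- 2-cells `(a, r, φ) ⟶ (b, s, ψ)`: pairs `(α, θ)` with `α : a ⟶ b` and `θ : r ⟶ s` such that
`θ` represents `Y^α` (with respect to `φ` and `ψ`). -/
@[ext] structure Hom₂ {x y : Ob π} (f g : Hom x y) where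
  α : f.a ⟶ g.a
  θ : f.r ⟶ g.r
  comm : f.φ.hom ≫ y.pr ◁ c.map₂ θ = Y.map₂ (op2 α) ▷ x.pr ≫ g.φ.hom

/-- The composite of `(a, r, φ)` and `(a', r', φ')` is `(a' a, r r', r φ' ∘ φ Y^{a'})`. -/
instance : CategoryStruct (Ob π) where
  Hom x y := Hom x y
  id x := { a := 𝟙 x.j, r := 𝟙 x.val, φ := pasteId x.pr }
  comp f f' := { a := f.a ≫ f'.a, r := f'.r ≫ f.r, φ := paste f.φ f'.φ }

/-- 2-cells are composed vertically componentwise. -/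
instance (x y : Ob π) : Category (x ⟶ y) where
  Hom f g := Hom₂ f g
  id f := { α := 𝟙 f.a, θ := 𝟙 f.r, comm := by simp }
  comp m n :=
    { α := m.α ≫ n.α
      θ := m.θ ≫ n.θ
      comm := by
        rw [c.map₂_comp, whiskerLeft_comp, reassoc_of% m.comm, n.comm]
        simp }
  id_comp m := Hom₂.ext (Category.id_comp m.α) (Category.id_comp m.θ)
  comp_id m := Hom₂.ext (Category.comp_id m.α) (Category.comp_id m.θ)
  assoc m n o := Hom₂.ext (Category.assoc m.α n.α o.α) (Category.assoc m.θ n.θ o.θ)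

lemma hom₂_ext {x y : Ob π} {f g : x ⟶ y} {m n : f ⟶ g} (h : m.α = n.α) (h' : m.θ = n.θ) :
    m = n := Hom₂.ext h h'

/-- A 2-cell with invertible components is invertible. -/
def isoMk {x y : Ob π} {f g : x ⟶ y} (α : f.a ≅ g.a) (θ : f.r ≅ g.r)
    (comm : f.φ.hom ≫ y.pr ◁ c.map₂ θ.hom = Y.map₂ (op2 α.hom) ▷ x.pr ≫ g.φ.hom) : f ≅ g where
  hom := { α := α.hom, θ := θ.hom, comm := comm }
  inv :=
    { α := α.inv
      θ := θ.inv
      comm := by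
        have h : Y.map₂ (op2 α.inv) ▷ x.pr ≫ Y.map₂ (op2 α.hom) ▷ x.pr = 𝟙 _ := by
          rw [← comp_whiskerRight, ← Y.map₂_comp, ← op2_comp, α.inv_hom_id]
          simp
        have h' : y.pr ◁ c.map₂ θ.hom ≫ y.pr ◁ c.map₂ θ.inv = 𝟙 _ := by
          rw [← whiskerLeft_comp, ← c.map₂_comp, θ.hom_inv_id]
          simp
        have e := congr(Y.map₂ (op2 α.inv) ▷ x.pr ≫ $comm ≫ y.pr ◁ c.map₂ θ.inv)
        simp only [Category.assoc, h'] at e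
        rw [reassoc_of% h] at e
        rw [← e, Category.comp_id] }
  hom_inv_id := hom₂_ext α.hom_inv_id θ.hom_inv_id
  inv_hom_id := hom₂_ext α.inv_hom_id θ.inv_hom_id

/-- Whiskering on the left, componentwise. -/
def whiskL {x y z : Ob π} (f : x ⟶ y) {g h : y ⟶ z} (m : g ⟶ h) : f ≫ g ⟶ f ≫ h :=
  Hom₂.mk (f := f ≫ g) (g := f ≫ h) (f.a ◁ Hom₂.α m) (Hom₂.θ m ▷ f.r)
    (paste_left f.φ g.φ h.φ (Hom₂.α m) (Hom₂.θ m) (Hom₂.comm m))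

/-- Whiskering on the right, componentwise. -/
def whiskR {x y z : Ob π} {f g : x ⟶ y} (m : f ⟶ g) (h : y ⟶ z) : f ≫ h ⟶ g ≫ h :=
  Hom₂.mk (f := f ≫ h) (g := g ≫ h) (Hom₂.α m ▷ h.a) (h.r ◁ Hom₂.θ m)
    (paste_right f.φ g.φ h.φ (Hom₂.α m) (Hom₂.θ m) (Hom₂.comm m))

instance : Bicategory (Ob π) where
  whiskerLeft f _ _ m := whiskL f m
  whiskerRight m h := whiskR m h
  associator f g h := isoMk (α_ f.a g.a h.a) (α_ h.r g.r f.r).symm (paste_assoc f.φ g.φ h.φ)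
  leftUnitor f := isoMk (λ_ f.a) (ρ_ f.r) (paste_id_left f.φ)
  rightUnitor f := isoMk (ρ_ f.a) (λ_ f.r) (paste_id_right f.φ)
  whiskerLeft_id _ _ := hom₂_ext (whiskerLeft_id _ _) (id_whiskerRight _ _)
  whiskerLeft_comp _ _ _ _ _ _ := hom₂_ext (whiskerLeft_comp _ _ _) (comp_whiskerRight _ _ _)
  id_whiskerLeft _ := hom₂_ext (id_whiskerLeft _) (whiskerRight_id _)
  comp_whiskerLeft _ _ _ _ _ := hom₂_ext (comp_whiskerLeft _ _ _) (whiskerRight_comp _ _ _)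
  id_whiskerRight _ _ := hom₂_ext (id_whiskerRight _ _) (whiskerLeft_id _ _)
  comp_whiskerRight _ _ _ := hom₂_ext (comp_whiskerRight _ _ _) (whiskerLeft_comp _ _ _)
  whiskerRight_id _ := hom₂_ext (whiskerRight_id _) (id_whiskerLeft _)
  whiskerRight_comp _ _ _ := hom₂_ext (whiskerRight_comp _ _ _) (comp_whiskerLeft _ _ _)
  whisker_assoc _ _ _ _ _ := hom₂_ext (whisker_assoc _ _ _) (whisker_assoc_symm _ _ _)
  whisker_exchange _ _ := hom₂_ext (whisker_exchange _ _) (whisker_exchange _ _).symm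
  pentagon f g h k := hom₂_ext (pentagon _ _ _ _) (pentagon_inv k.r h.r g.r f.r)
  triangle f g := hom₂_ext (triangle _ _) (triangle_assoc_comp_right g.r f.r)

lemma eq_of_iso {x y : Ob π} {f g : x ⟶ y} (m : f ⟶ g) (ha : f.a = g.a) (hr : f.r = g.r)
    (hα : Hom₂.α m = eqToHom ha) (hθ : Hom₂.θ m = eqToHom hr) : f = g := by
  obtain ⟨a, r, φ⟩ := f
  obtain ⟨b, s, ψ⟩ := g
  obtain ⟨α, θ, e⟩ := m
  dsimp only at ha hr
  subst ha hr
  dsimp only [eqToHom_refl] at hα hθ e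
  subst hα hθ
  obtain rfl : φ = ψ := by
    ext
    simpa using e
  rfl

lemma eqToHom_α {x y : Ob π} {f g : x ⟶ y} (h : f = g) :
    Hom₂.α (eqToHom h) = eqToHom (congrArg Hom.a h) := by
  subst h; rfl

lemma eqToHom_θ {x y : Ob π} {f g : x ⟶ y} (h : f = g) :
    Hom₂.θ (eqToHom h) = eqToHom (congrArg Hom.r h) := by
  subst h; rfl

section
variable [Strict J] [Strict C] {x y z t : Ob π} (f : x ⟶ y) (g : y ⟶ z) (h : z ⟶ t)

lemma id_comp_eq : 𝟙 x ≫ f = f :=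
  eq_of_iso (λ_ f).hom (Strict.id_comp f.a) (Strict.comp_id f.r)
    (congrArg Iso.hom (Strict.leftUnitor_eqToIso f.a))
    (congrArg Iso.hom (Strict.rightUnitor_eqToIso f.r))

lemma comp_id_eq : f ≫ 𝟙 y = f :=
  eq_of_iso (ρ_ f).hom (Strict.comp_id f.a) (Strict.id_comp f.r)
    (congrArg Iso.hom (Strict.rightUnitor_eqToIso f.a))
    (congrArg Iso.hom (Strict.leftUnitor_eqToIso f.r))

lemma assoc_eq : (f ≫ g) ≫ h = f ≫ g ≫ h :=
  eq_of_iso (α_ f g h).hom (Strict.assoc f.a g.a h.a)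
    (Strict.assoc h.r g.r f.r).symm (congrArg Iso.hom (Strict.associator_eqToIso f.a g.a h.a))
    (congrArg Iso.inv (Strict.associator_eqToIso h.r g.r f.r))

lemma leftUnitor_eq : (λ_ f) = eqToIso (id_comp_eq f) := by
  refine Iso.ext (hom₂_ext (x := x) (y := y) ?_ ?_)
  · exact (congrArg Iso.hom (Strict.leftUnitor_eqToIso f.a)).trans (eqToHom_α (id_comp_eq f)).symm
  · exact (congrArg Iso.hom (Strict.rightUnitor_eqToIso f.r)).trans (eqToHom_θ (id_comp_eq f)).symm

lemma rightUnitor_eq : (ρ_ f) = eqToIso (comp_id_eq f) := by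
  refine Iso.ext (hom₂_ext (x := x) (y := y) ?_ ?_)
  · exact (congrArg Iso.hom (Strict.rightUnitor_eqToIso f.a)).trans (eqToHom_α (comp_id_eq f)).symm
  · exact (congrArg Iso.hom (Strict.leftUnitor_eqToIso f.r)).trans (eqToHom_θ (comp_id_eq f)).symm

lemma associator_eq : (α_ f g h) = eqToIso (assoc_eq f g h) := by
  refine Iso.ext (hom₂_ext (x := x) (y := t) ?_ ?_)
  · exact (congrArg Iso.hom (Strict.associator_eqToIso f.a g.a h.a)).trans (eqToHom_α (assoc_eq f g h)).symm
  · exact (congrArg Iso.inv (Strict.associator_eqToIso h.r g.r f.r)).trans (eqToHom_θ (assoc_eq f g h)).symm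

/-- Over 2-categories, `K` is a 2-category. -/
instance : Strict (Ob π) where
  id_comp f := id_comp_eq f
  comp_id f := comp_id_eq f
  assoc f g h := assoc_eq f g h
  leftUnitor_eqToIso f := leftUnitor_eq f
  rightUnitor_eqToIso f := rightUnitor_eq f
  associator_eqToIso f g h := associator_eq f g h

end

end KCat

/-- A 2-pro-object of `C`: a 2-functor `X : Iᵒᵖ ⥤ C`, where `I` is a small 2-filtered
2-category. -/
structure TwoProObj (C : Type u) [Bicategory.{v, v} C] where
  Idx : Type v
  [bicategory : Bicategory.{v, v} Idx]
  [strict : Strict Idx]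
  [filtered : IsTwoFiltered Idx]
  diag : StrictPseudofunctor Idxᵒᵖ C

namespace TwoProObj

attribute [instance] bicategory strict filtered

variable {C : Type u} [Bicategory.{v, v} C] [Strict C]

/-- The 2-functor `L X = colim_i C(X_i, -)` from `C` to `Cat`. -/
noncomputable def L (X : TwoProObj C) : TwoHom C Cat.{v, v} :=
  ⟨StrictPseudofunctor.mk'' (TwoColim.LPre X.diag.toPseudofunctor)⟩

/-- The object `X_i` of `C`. -/
abbrev val (X : TwoProObj C) (i : X.Idx) : C := X.diag.obj (op i)

/-- The pseudocolimit inclusion `C(X_i, -) ⟶ L X`; under the 2-dimensional Yoneda lemma it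
corresponds to the object `(𝟙, i)` of `(L X)(X_i)`. -/
noncomputable def incl (X : TwoProObj C) (i : X.Idx) :
    TwoHom.mk (reprTwo (X.val i)) ⟶ X.L where
  app B := (TwoColim.incl X.diag.toPseudofunctor B i).toCatHom
  naturality {B B'} g := by
    refine congrArg Functor.toCatHom (a₁ := postFunctor _ g ⋙ TwoColim.incl _ B' i)
      (a₂ := TwoColim.incl _ B i ⋙ TwoColim.post g) ?_
    refine CategoryTheory.Functor.ext (fun r => rfl) fun r s θ => ?_
    erw [eqToHom_refl, eqToHom_refl, Category.id_comp, Category.comp_id]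
    exact (TwoColim.post_map_incl g θ).symm
  naturality₂ {B B'} g g' γ := by
    ext r
    simp only [Cat.Hom₂.comp_app]
    erw [Cat.eqToHom_app, Cat.eqToHom_app]
    erw [eqToHom_refl, eqToHom_refl, Category.id_comp, Category.comp_id]
    rfl

end TwoProObj

/-- The 2-category `2-Pro(C)`: its objects are the 2-pro-objects, and its hom categories are
`2-Pro(C)(X, Y) = Hom(C, Cat)(L Y, L X)`. -/
abbrev TwoPro (C : Type u) [Bicategory.{v, v} C] [Strict C] :=
  InducedBicategory (TwoHom C Cat.{v, v})ᵒᵖ (fun X : TwoProObj C => op X.L)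

section IndexTwoCategory

variable {C : Type u} [Bicategory.{v, v} C] [Strict C]

/-- The projection `π_i : X ⟶ X_i`, where `X_i` is regarded as the 2-pro-object represented by
`C(X_i, -)`. -/
noncomputable def TwoProObj.proj (X : TwoProObj C) (i : X.Idx) :
    op X.L ⟶ (yonedaTwo C).obj (X.val i) :=
  (X.incl i).op

variable {J : Type v} [Bicategory.{v, v} J] [Strict J]

variable (X : StrictPseudofunctor Jᵒᵖ (TwoPro C))

/-- The diagram `X`, regarded as a 2-functor into `Hom(C, Cat)ᵒᵖ`, where `2-Pro(C)` sits as a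
2-full sub-2-category. -/
noncomputable def diagL : Jᵒᵖ ⥤ᵖ (TwoHom C Cat.{v, v})ᵒᵖ :=
  (X.comp InducedBicategory.forget).toPseudofunctor

/-- The 2-pro-object `X^j`. -/
abbrev pro (j : J) : TwoProObj C := X.obj (op j)

/-- The projections `π^j_i : X^j ⟶ X^j_i`. -/
noncomputable def diagProj (j : J) (i : (pro X j).Idx) :
    (diagL X).obj (op j) ⟶ (yonedaTwo C).toPseudofunctor.obj ((pro X j).val i) :=
  (pro X j).proj i

/-- The index 2-category `K_X` of a diagram `X : Jᵒᵖ ⥤ 2-Pro(C)` of 2-pro-objects. -/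
noncomputable abbrev KX : Type v := KCat.Ob (diagProj X)

end IndexTwoCategory

/-! The 2-category `K_X` is compared with `J` through `(i, j) ↦ j`, `(a, r, φ) ↦ a`, `(α, θ) ↦ α`.
Each axiom is first solved in `J`, and the solution is then lifted to `K_X`. Three lifting
properties carry this. A 1-cell of `J` out of `j` lifts to a 1-cell out of any given `(i, j)`
(`exists_hom_over`). A 2-cell between the bases of two parallel 1-cells lifts after postcomposition
with a 1-cell over an identity (`exists_hom₂_over`). Two 2-cells with the same base become equal
after such a postcomposition (`exists_whiskR_eq`). For F1 the lifted 2-cell must be invertible: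
lifts of an isomorphism and of its inverse compose to 2-cells over identities, and these become
identities further along (`exists_iso_over`).

The lifting properties use only four facts about the projections `π_i`, collected in
`IsProjectionSystem`. They hold for a 2-pro-object because of Yoneda and the explicit form of the
colimit `L X`. A 1-cell from `X` to `B` is an object of `(L X)(B)`, hence a pair `(r, i)`, hence
`π_i` followed by `r`. A 2-cell between two such composites with the same `i` is a homotopy class of
premorphisms `(r, i) ⟶ (s, i)`. Each axiom for the index `I` of `X` then has one task: F0 provides a
common index; F1 makes the two legs of a premorphism isomorphic, so that it comes from a 2-cell `X_u
≫ r ⟶ X_u ≫ s` of `C` (`exists_comp_moveIso`); F2 makes the two 2-cells of a homotopy equal, so that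
2-cells identified in the colimit already agree after whiskering with some `X_u`
(`exists_whiskerLeft_eq`). -/

namespace KCat

/-! ### Abstract properties of the projections of a 2-pro-object -/

section ProjectionSystem

variable {C : Type u} [Bicategory.{w, v} C] {P : Type u₂} [Bicategory.{w₂, v₂} P] {c : C ⥤ᵖ P}

/-- The isomorphism `p ≫ c(r) ≅ q ≫ c(u ≫ r)` induced by `p ≅ q ≫ c(u)`. -/
def shift {Z : P} {A A' B : C} {p : Z ⟶ c.obj A} {q : Z ⟶ c.obj A'} {u : A' ⟶ A}
    (e : p ≅ q ≫ c.map u) (r : A ⟶ B) : p ≫ c.map r ≅ q ≫ c.map (u ≫ r) :=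
  whiskerRightIso e (c.map r) ≪≫ α_ _ _ _ ≪≫ whiskerLeftIso q (c.mapComp u r).symm

/-- A family of 1-cells `p_i : Z ⟶ c(Z_i)` which behaves like the projections of a 2-pro-object:
every 1-cell `Z ⟶ c(B)` factors through some `p_i`, and the 2-cells between such factorizations
are computed in `C` up to moving to a later index. -/
structure IsProjectionSystem {Z : P} {Idx : Type u₃} {ob : Idx → C}
    (p : ∀ i, Z ⟶ c.obj (ob i)) : Prop where
  exists_factor {B : C} (h : Z ⟶ c.obj B) :
    ∃ (i : Idx) (r : ob i ⟶ B), Nonempty (h ≅ p i ≫ c.map r)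
  exists_common (i i' : Idx) :
    ∃ (k : Idx) (u : ob k ⟶ ob i) (u' : ob k ⟶ ob i'),
      Nonempty (p i ≅ p k ≫ c.map u) ∧ Nonempty (p i' ≅ p k ≫ c.map u')
  exists_lift {i : Idx} {B : C} {r s : ob i ⟶ B} (γ : p i ≫ c.map r ⟶ p i ≫ c.map s) :
    ∃ (k : Idx) (u : ob k ⟶ ob i) (e : p i ≅ p k ≫ c.map u) (θ : u ≫ r ⟶ u ≫ s),
      γ ≫ (shift e s).hom = (shift e r).hom ≫ p k ◁ c.map₂ θ
  exists_eq {i : Idx} {B : C} {r s : ob i ⟶ B} {θ θ' : r ⟶ s}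
    (h : p i ◁ c.map₂ θ = p i ◁ c.map₂ θ') :
    ∃ (k : Idx) (u : ob k ⟶ ob i) (_ : p i ≅ p k ≫ c.map u), u ◁ θ = u ◁ θ'

end ProjectionSystem

/-! ### Lifting cells from `J` to the index 2-category, and its 2-filteredness -/

variable {J : Type u₁} [Bicategory.{w₁, v₁} J] {C : Type u} [Bicategory.{w, v} C]
  {P : Type u₂} [Bicategory.{w₂, v₂} P] {Y : Jᵒᵖ ⥤ᵖ P} {c : C ⥤ᵖ P} {Idx : J → Type u₃}
  {ob : ∀ j, Idx j → C} {π : ∀ j (i : Idx j), Y.obj (op j) ⟶ c.obj (ob j i)}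

/-- The 1-cell `(i, j) ⟶ (k, j)` over `𝟙 j` given by `π_i ≅ π_k ≫ c(u)`. -/
def trans {j : J} {i k : Idx j} {u : ob j k ⟶ ob j i} (e : π j i ≅ π j k ≫ c.map u) :
    (⟨j, i⟩ : Ob π) ⟶ ⟨j, k⟩ :=
  Hom.mk (x := (⟨j, i⟩ : Ob π)) (y := ⟨j, k⟩) (𝟙 j) u
    (whiskerRightIso (Y.mapId (op j)) (π j i) ≪≫ λ_ _ ≪≫ e)

/-- Since `trans e` lies over an identity, pasting with it only changes `φ` by `shift e`. By
interchange the unit comparison of `Y` moves past `φ`, and what remains of it is the image of a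
right unitor of `J`. -/
lemma paste_trans {x : Ob π} {j : J} {i k : Idx j} {u : ob j k ⟶ ob j i}
    (e : π j i ≅ π j k ≫ c.map u) (f : x ⟶ ⟨j, i⟩) :
    (paste (Hom.φ f) (Hom.φ (trans e))).hom =
      Y.map₂ (op2 (ρ_ (Hom.a f)).hom) ▷ x.pr ≫ (Hom.φ f).hom ≫ (shift e (Hom.r f)).hom := by
  have h : Y.map (𝟙 (op j)) ◁ (Hom.φ f).hom ≫ (α_ _ _ _).inv ≫
      (Y.mapId (op j)).hom ▷ π j i ▷ c.map (Hom.r f) =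
      (α_ _ _ _).inv ≫ (Y.mapId (op j)).hom ▷ Y.map (Hom.a f).op ▷ x.pr ≫ (α_ _ _ _).hom ≫
        (λ_ _).hom ≫ (Hom.φ f).hom ≫ (λ_ _).inv ≫ (α_ _ _ _).inv := by
    have := whisker_exchange (Y.mapId (op j)).hom (Hom.φ f).hom
    simp only [whiskerRight_comp, Category.assoc, id_whiskerLeft] at this
    rw [← cancel_mono (α_ _ _ _).hom]
    simpa using this
  simp [paste, trans, shift]
  rw [reassoc_of% h]
  simp

/-- Every 1-cell of `J` starting at `j` is covered by a 1-cell of `K` starting at `(i, j)`. -/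
lemma exists_hom_over (hπ : ∀ j, IsProjectionSystem (π j)) (x : Ob π) {j : J} (a : x.j ⟶ j) :
    ∃ (k : Idx j) (f : x ⟶ ⟨j, k⟩), Hom.a f = a := by
  obtain ⟨k, r, ⟨φ⟩⟩ := (hπ j).exists_factor (Y.map a.op ≫ x.pr)
  exact ⟨k, Hom.mk (x := x) (y := ⟨j, k⟩) a r φ, rfl⟩

/-- Conjugating the whiskered image of `α` under `Y` by the representing isomorphisms of `f` and `g`
gives a 2-cell between `π_i` followed by `f.r` and `π_i` followed by `g.r`. By `exists_lift` it
comes from a 2-cell of `C` at a later index `k`, and the 1-cell `trans e` to that index is the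
required `h`. -/
lemma exists_hom₂_over (hπ : ∀ j, IsProjectionSystem (π j)) {x y : Ob π} (f g : x ⟶ y)
    (α : Hom.a f ⟶ Hom.a g) :
    ∃ (z : Ob π) (h : y ⟶ z) (m : f ≫ h ⟶ g ≫ h), Hom₂.α m = α ▷ Hom.a h := by
  obtain ⟨j, i⟩ := y
  obtain ⟨k, u, e, θ, hθ⟩ := (hπ j).exists_lift
    ((Hom.φ f).inv ≫ Y.map₂ (op2 α) ▷ x.pr ≫ (Hom.φ g).hom)
  refine ⟨⟨j, k⟩, trans e, Hom₂.mk (f := f ≫ trans e) (g := g ≫ trans e)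
    (α ▷ 𝟙 j) θ ?_, rfl⟩
  -- Once both pastings are rewritten by `paste_trans`, the compatibility condition is `hθ` together
  -- with naturality of the right unitor of `J`.
  refine (congrArg (· ≫ _) (paste_trans e f)).trans
    (Eq.trans ?_ (congrArg (_ ≫ ·) (paste_trans e g)).symm)
  have h : Y.map₂ (op2 (ρ_ (Hom.a f)).hom) ▷ x.pr ≫ Y.map₂ (op2 α) ▷ x.pr =
      Y.map₂ (op2 (α ▷ 𝟙 j)) ▷ x.pr ≫ Y.map₂ (op2 (ρ_ (Hom.a g)).hom) ▷ x.pr := by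
    simp only [← comp_whiskerRight, ← Y.map₂_comp, ← op2_comp, rightUnitor_naturality]
  simp only [Category.assoc] at hθ
  change (Y.map₂ (op2 (ρ_ (Hom.a f)).hom) ▷ x.pr ≫ (Hom.φ f).hom ≫ (shift e (Hom.r f)).hom) ≫
    π j k ◁ c.map₂ θ = Y.map₂ (op2 (α ▷ 𝟙 j)) ▷ x.pr ≫
      Y.map₂ (op2 (ρ_ (Hom.a g)).hom) ▷ x.pr ≫ (Hom.φ g).hom ≫ (shift e (Hom.r g)).hom
  rw [Category.assoc, Category.assoc, ← hθ, Iso.hom_inv_id_assoc, reassoc_of% h]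

/-- With equal bases, the compatibility conditions of `m` and `n` have the same right-hand side.
Cancelling the invertible `φ` of `f` shows that the two components in `C` agree after whiskering
with `π_i`, and `exists_eq` applies. -/
lemma exists_whiskR_eq (hπ : ∀ j, IsProjectionSystem (π j)) {x y : Ob π} {f g : x ⟶ y}
    (m n : f ⟶ g) (hα : Hom₂.α m = Hom₂.α n) :
    ∃ (z : Ob π) (h : y ⟶ z), m ▷ h = n ▷ h := by
  obtain ⟨j, i⟩ := y
  have hm := Hom₂.comm m
  rw [hα, ← Hom₂.comm n, cancel_epi] at hm
  obtain ⟨k, u, e, hu⟩ := (hπ j).exists_eq hm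
  exact ⟨⟨j, k⟩, trans e, hom₂_ext (congrArg (· ▷ 𝟙 j) hα) hu⟩

lemma whiskerRight_α {x y z : Ob π} {f g : x ⟶ y} (m : f ⟶ g) (h : y ⟶ z) :
    Hom₂.α (m ▷ h) = Hom₂.α m ▷ Hom.a h := rfl

lemma comp_α {x y : Ob π} {f g h : x ⟶ y} (m : f ⟶ g) (n : g ⟶ h) :
    Hom₂.α (m ≫ n) = Hom₂.α m ≫ Hom₂.α n := rfl

/-- A lift of `γ` need not be invertible. It becomes so after two corrections, one for each
composite with a lift of the inverse of `γ`. -/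
lemma exists_iso_over (hπ : ∀ j, IsProjectionSystem (π j)) {x y : Ob π} (f g : x ⟶ y)
    (γ : Hom.a f ≅ Hom.a g) :
    ∃ (z : Ob π) (h : y ⟶ z), Nonempty (f ≫ h ≅ g ≫ h) := by
  obtain ⟨z, h, m, hm⟩ := exists_hom₂_over hπ f g γ.hom
  -- The inverse is lifted between the 1-cells already postcomposed with `h`, so that `m ▷ h'` and
  -- `n` are composable in both orders.
  obtain ⟨z', h', n, hn⟩ := exists_hom₂_over hπ (g ≫ h) (f ≫ h) (γ.inv ▷ Hom.a h)
  -- This composite lies over `γ` followed by its inverse, hence over an identity, and so becomes an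
  -- identity after whiskering with some `l`.
  obtain ⟨t, l, hl⟩ := exists_whiskR_eq hπ (m ▷ h' ≫ n) (𝟙 _) (by
    rw [comp_α, whiskerRight_α, hm, hn, ← comp_whiskerRight, ← comp_whiskerRight, γ.hom_inv_id]
    simp only [id_whiskerRight]
    exact id_whiskerRight _ _)
  -- The other composite is corrected after `l`; whiskering with `l'` preserves the equation
  -- obtained for the first one.
  obtain ⟨t', l', hl'⟩ := exists_whiskR_eq hπ (n ▷ l ≫ m ▷ h' ▷ l) (𝟙 _) (by
    rw [comp_α, whiskerRight_α, whiskerRight_α, whiskerRight_α, hm, hn, ← comp_whiskerRight,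
      ← comp_whiskerRight, ← comp_whiskerRight, γ.inv_hom_id]
    simp only [id_whiskerRight]
    exact (congrArg (· ▷ _) (id_whiskerRight _ _)).trans (id_whiskerRight _ _))
  let i : ((f ≫ h) ≫ h') ≫ l ≫ l' ≅ ((g ≫ h) ≫ h') ≫ l ≫ l' :=
    (α_ _ _ _).symm ≪≫
    { hom := m ▷ h' ▷ l ▷ l'
      inv := n ▷ l ▷ l'
      hom_inv_id := by
        rw [← comp_whiskerRight, ← comp_whiskerRight, hl]
        simp
      inv_hom_id := by
        rw [← comp_whiskerRight, hl']
        simp } ≪≫ α_ _ _ _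
  exact ⟨t', h ≫ h' ≫ l ≫ l', ⟨(α_ _ _ _).symm ≪≫ (α_ _ _ _).symm ≪≫ i ≪≫ α_ _ _ _ ≪≫ α_ _ _ _⟩⟩

/-- The index 2-category of a 2-filtered diagram of objects with projection systems is
2-filtered. -/
theorem isTwoFiltered [IsTwoFiltered J] (hπ : ∀ j, IsProjectionSystem (π j)) :
    IsTwoFiltered (Ob π) where
  f0 x y := by
    obtain ⟨j, ⟨a⟩, ⟨b⟩⟩ := IsTwoFiltered.f0 x.j y.j
    obtain ⟨i, f, -⟩ := exists_hom_over hπ x a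
    obtain ⟨i', g, -⟩ := exists_hom_over hπ y b
    -- The two lifts end over the same `j` but at different indices of `Y^j`, which are joined by
    -- 1-cells over `𝟙 j`.
    obtain ⟨k, u, u', ⟨e⟩, ⟨e'⟩⟩ := (hπ j).exists_common i i'
    exact ⟨⟨j, k⟩, ⟨f ≫ trans e⟩, ⟨g ≫ trans e'⟩⟩
  f1 {x y} f g := by
    obtain ⟨j, a, ⟨γ⟩⟩ := IsTwoFiltered.f1 (Hom.a f) (Hom.a g)
    -- Substituting `a` by the base of `h` turns `γ` into an isomorphism between the bases of `f ≫
    -- h` and `g ≫ h`.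
    obtain ⟨k, h, rfl⟩ := exists_hom_over hπ y a
    obtain ⟨z, h', ⟨i⟩⟩ := exists_iso_over hπ (f ≫ h) (g ≫ h) γ
    exact ⟨z, h ≫ h', ⟨(α_ _ _ _).symm ≪≫ i ≪≫ α_ _ _ _⟩⟩
  f2 {x y f g} m n := by
    obtain ⟨j, a, hγ⟩ := IsTwoFiltered.f2 (Hom₂.α m) (Hom₂.α n)
    obtain ⟨k, h, rfl⟩ := exists_hom_over hπ y a
    obtain ⟨z, h', i⟩ := exists_whiskR_eq hπ (m ▷ h) (n ▷ h) hγ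
    refine ⟨z, h ≫ h', ?_⟩
    rw [whiskerRight_comp, whiskerRight_comp, i]

end KCat

/-! ### Changing the index in the pseudocolimit: fullness and faithfulness up to a later index -/

namespace TwoColim

section Comparison

variable {I : Type v} [Bicategory.{v, v} I] {C : Type u} [Bicategory.{v, v} C]
  {X : Iᵒᵖ ⥤ᵖ C} {B B' : C}

variable (X) in
/-- The comparison `t ≅ X_𝟙 ≫ t`. -/
def unitIso {k : I} (t : X.obj (op k) ⟶ B) : t ≅ res X (𝟙 k) ≫ t :=
  (λ_ t).symm ≪≫ whiskerRightIso (X.mapId (op k)).symm t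

lemma unitIso_naturality {k : I} {t t' : X.obj (op k) ⟶ B} (θ : t ⟶ t') :
    θ ≫ (unitIso X t').hom = (unitIso X t).hom ≫ res X (𝟙 k) ◁ θ := by
  simp only [unitIso, Iso.trans_hom, Iso.symm_hom, whiskerRightIso_hom, Category.assoc]
  erw [← whisker_exchange]
  simp

/-- Needed for the compatibility of `moveIso` with postcomposition, which makes the isomorphisms
`moveIso u r` a modification in `B`. -/
lemma wh_unitIso (g : B ⟶ B') {i k : I} (u : i ⟶ k) (r : X.obj (op i) ⟶ B) :
    wh (v := 𝟙 k) g (unitIso X (res X u ≫ r)).hom =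
      (unitIso X (res X u ≫ r ≫ g)).hom ≫ res X (𝟙 k) ◁ (α_ _ _ _).inv := by
  rw [← unitIso_naturality]
  simp [wh, unitIso]
  rfl

lemma act_whisker {i k : I} {u u' : i ⟶ k} (β : u ⟶ u') {r s : X.obj (op i) ⟶ B} (θ : r ⟶ s) :
    act X β r ≫ res X u' ◁ θ = res X u ◁ θ ≫ act X β s :=
  (whisker_exchange _ _).symm

end Comparison

variable {I : Type v} [Bicategory.{v, v} I] [IsTwoFiltered I] {C : Type u} [Bicategory.{v, v} C]
  {X : Iᵒᵖ ⥤ᵖ C} {B B' : C}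

/-- The isomorphism `(r, i) ≅ (X_u ≫ r, k)` for `u : i ⟶ k`. -/
def moveIso {i k : I} (u : i ⟶ k) (r : X.obj (op i) ⟶ B) :
    (⟨i, r⟩ : Obj X B) ≅ ⟨k, res X u ≫ r⟩ where
  hom := homMk (x := (⟨i, r⟩ : Obj X B)) (y := ⟨k, res X u ≫ r⟩)
    ⟨k, u, 𝟙 k, (unitIso X (res X u ≫ r)).hom⟩
  inv := homMk (x := (⟨k, res X u ≫ r⟩ : Obj X B)) (y := ⟨i, r⟩)
    ⟨k, 𝟙 k, u, (unitIso X (res X u ≫ r)).inv⟩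
  hom_inv_id := by
    -- The two representatives share their top object and middle leg, so they compose without being
    -- moved. The result is the identity premorphism moved along `u`, which is homotopic to the
    -- identity.
    rw [homMk_comp_of_isComp ⟨_, _, _, _, _, _, Exp.refl _, Exp.refl _, rfl⟩, ← homMk_idPre,
      homMk_eq_of_exp (idPre_exp _ u), Iso.hom_inv_id]
  inv_hom_id := by
    rw [homMk_comp_of_isComp ⟨_, _, _, _, _, _, Exp.refl _, Exp.refl _, rfl⟩, ← homMk_idPre,
      homMk_eq_of_exp (idPre_exp _ (𝟙 k)), Iso.inv_hom_id]

lemma moveIso_naturality {i k : I} (u : i ⟶ k) {r s : X.obj (op i) ⟶ B} (θ : r ⟶ s) :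
    (incl X B i).map θ ≫ (moveIso u s).hom =
      (moveIso u r).hom ≫ (incl X B k).map (res X u ◁ θ) := by
  refine (incl_map_comp θ _).trans (Eq.trans ?_ (comp_incl_map (res X u ◁ θ) _).symm)
  exact congrArg (fun c => homMk (x := (⟨i, r⟩ : Obj X B)) (y := ⟨k, res X u ≫ s⟩)
    ⟨k, u, 𝟙 k, c⟩) (unitIso_naturality _)

lemma post_map_moveIso (g : B ⟶ B') {i k : I} (u : i ⟶ k) (r : X.obj (op i) ⟶ B) :
    (post g).map (moveIso u r).hom =
      (moveIso u (r ≫ g)).hom ≫ (incl X B' k).map (α_ (res X u) r g).inv := by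
  refine Eq.trans ?_ (comp_incl_map (α_ (res X u) r g).inv _).symm
  exact congrArg (fun c => homMk (x := (⟨i, r ≫ g⟩ : Obj X B'))
    (y := ⟨k, (res X u ≫ r) ≫ g⟩) ⟨k, u, 𝟙 k, c⟩) (wh_unitIso g u r)

/-- A premorphism from index `i` to index `i` has two parallel legs. F1 makes them isomorphic, and a
premorphism with equal legs is, up to `moveIso`, the inclusion of a 2-cell of `C`. -/
lemma exists_comp_moveIso {i : I} {r s : X.obj (op i) ⟶ B} (f : (⟨i, r⟩ : Obj X B) ⟶ ⟨i, s⟩) :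
    ∃ (k : I) (u : i ⟶ k) (θ : res X u ≫ r ⟶ res X u ≫ s),
      f ≫ (moveIso u s).hom = (moveIso u r).hom ≫ (incl X B k).map θ := by
  obtain ⟨⟨k, u, v, θ⟩, rfl⟩ := homMk_surjective f
  -- The left leg is kept as `u ≫ w`, and `γ` replaces the right leg `v ≫ w` by the same 1-cell.
  obtain ⟨m, w, ⟨γ⟩⟩ := IsTwoFiltered.f1 v u
  let η : res X (u ≫ w) ≫ r ⟶ res X (u ≫ w) ≫ s :=
    mv (i := i) (j := i) (r := r) (s := s) w (Iso.refl _) γ θ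
  refine ⟨m, u ≫ w, η, ?_⟩
  rw [homMk_eq_of_exp (x := (⟨i, r⟩ : Obj X B)) (y := ⟨i, s⟩) (q := ⟨m, u ≫ w, u ≫ w, η⟩)
    ⟨w, Iso.refl _, γ, rfl⟩]
  -- Both sides are now represented with legs `u ≫ w` and `𝟙 m`, and their cells agree by naturality
  -- of `unitIso`.
  refine (homMk_comp_of_isComp ⟨_, _, _, _, _, _, Exp.refl _, Exp.refl _, rfl⟩).trans
    (Eq.trans ?_ (comp_incl_map _ _).symm)
  exact congrArg (fun c => homMk (x := (⟨i, r⟩ : Obj X B)) (y := ⟨m, res X (u ≫ w) ≫ s⟩)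
    ⟨m, u ≫ w, 𝟙 m, c⟩) (unitIso_naturality _)

/-- Equality in the colimit is a homotopy with two invertible 2-cells `α` and `β`, one for each leg.
Here both legs are identities, so `α` and `β` are parallel, and F2 makes them equal; they can then
be cancelled. -/
lemma exists_whiskerLeft_eq {i : I} {r s : X.obj (op i) ⟶ B} {θ θ' : r ⟶ s}
    (h : (incl X B i).map θ = (incl X B i).map θ') :
    ∃ (k : I) (u : i ⟶ k), res X u ◁ θ = res X u ◁ θ' := by
  obtain ⟨m, w₁, w₂, α, β, e⟩ := homMk_eq_iff.1 h
  obtain ⟨n, z, hz⟩ := IsTwoFiltered.f2 α.hom β.hom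
  dsimp only at w₁ w₂ α β e hz
  refine ⟨n, (𝟙 i ≫ w₁) ≫ z, ?_⟩
  -- Interchange brings `β` to the same side as `α`, so that both whiskered 2-cells are taken along
  -- `𝟙 i ≫ w₁`.
  rw [push_whisker, push_whisker, act_whisker] at e
  have e' := congrArg (push X z) e
  rw [push_comp, push_comp, push_act, push_act, push_whisker, push_whisker, hz, cancel_mono] at e'
  exact e'.symm

end TwoColim

/-! ### Uniqueness in the two-dimensional Yoneda lemma -/

section Representables

variable {C : Type u} [Bicategory.{v, v} C] [Strict C]

/-- Modifications out of a representable 2-functor are determined by their value at the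
identity. -/
lemma TwoHom.hom₂_ext_of_repr {B : C} {F : TwoHom C Cat.{v, v}} {σ τ : TwoHom.mk (reprTwo B) ⟶ F}
    {m n : σ ⟶ τ} (h : (m.app B).toNatTrans.app (𝟙 B) = (n.app B).toNatTrans.app (𝟙 B)) :
    m = n := by
  refine TwoHom.hom₂_ext fun D => ?_
  ext (t : B ⟶ D)
  -- The modification axiom at `t`, evaluated at an object `b`; with `b = 𝟙 B` it determines the
  -- component at `𝟙 B ≫ t`.
  have key (m : σ ⟶ τ) (b : (reprTwo B).obj B) :
      (m.app D).toNatTrans.app (((reprTwo B).map t).toFunctor.obj b) ≫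
        (eqToHom (τ.naturality t)).toNatTrans.app b =
      (eqToHom (σ.naturality t)).toNatTrans.app b ≫
        (F.fun₂.map t).toFunctor.map ((m.app B).toNatTrans.app b) :=
    congrArg (fun η => η.toNatTrans.app b) (m.naturality t)
  have hτ (b : (reprTwo B).obj B) :
      Mono ((eqToHom (τ.naturality t)).toNatTrans.app b) := by
    rw [Cat.eqToHom_app]
    infer_instance
  have e : (m.app D).toNatTrans.app (𝟙 B ≫ t) = (n.app D).toNatTrans.app (𝟙 B ≫ t) :=
    (hτ (𝟙 B)).right_cancellation _ _
      ((key m _).trans ((congrArg _ (congrArg _ h)).trans (key n _).symm))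
  -- Naturality of each component along the left unitor passes from `𝟙 B ≫ t` to `t` without
  -- transport along an equality of objects.
  have ext_of_iso {x y : (reprTwo B).obj D} (l : x ≅ y)
      (e : (m.app D).toNatTrans.app x = (n.app D).toNatTrans.app x) :
      (m.app D).toNatTrans.app y = (n.app D).toNatTrans.app y := by
    rw [← cancel_epi ((σ.app D).toFunctor.map l.hom), NatTrans.naturality, e,
      NatTrans.naturality]
  exact ext_of_iso (λ_ t) e

/-- 2-natural transformations out of a representable 2-functor are determined by their value at
the identity. -/
lemma TwoHom.hom_ext_of_repr {B : C} {F : TwoHom C Cat.{v, v}} {σ τ : TwoHom.mk (reprTwo B) ⟶ F}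
    (h : (σ.app B).toFunctor.obj (𝟙 B) = (τ.app B).toFunctor.obj (𝟙 B)) : σ = τ := by
  have hobj (σ : TwoHom.mk (reprTwo B) ⟶ F) {D : C} (t : B ⟶ D) :
      (σ.app D).toFunctor.obj t =
        (F.fun₂.map t).toFunctor.obj ((σ.app B).toFunctor.obj (𝟙 B)) :=
    (congrArg (σ.app D).toFunctor.obj (Strict.id_comp t).symm).trans
      (congrArg (fun G => G.toFunctor.obj (𝟙 B)) (σ.naturality t))
  -- The 2-dimensional naturality at `η` determines `σ` on `𝟙 B ◁ η`, up to identifications of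
  -- source and target. Heterogeneous equality absorbs these, and strictness identifies `𝟙 B ◁ η`
  -- with `η`.
  have hmap (σ : TwoHom.mk (reprTwo B) ⟶ F) {D : C} {t t' : B ⟶ D} (η : t ⟶ t') :
      (σ.app D).toFunctor.map η ≍
        (F.fun₂.map₂ η).toNatTrans.app ((σ.app B).toFunctor.obj (𝟙 B)) := by
    have key (b : (reprTwo B).obj B) :
        (σ.app D).toFunctor.map (((reprTwo B).map₂ η).toNatTrans.app b) ≫
          (eqToHom (σ.naturality t')).toNatTrans.app b =
        (eqToHom (σ.naturality t)).toNatTrans.app b ≫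
          (F.fun₂.map₂ η).toNatTrans.app ((σ.app B).toFunctor.obj b) :=
      congrArg (fun η => η.toNatTrans.app b) (σ.naturality₂ η)
    have key' (b : (reprTwo B).obj B) :
        (σ.app D).toFunctor.map (((reprTwo B).map₂ η).toNatTrans.app b) ≍
          (F.fun₂.map₂ η).toNatTrans.app ((σ.app B).toFunctor.obj b) := by
      have := heq_of_eq (key b)
      rw [Cat.eqToHom_app, Cat.eqToHom_app] at this
      exact (comp_eqToHom_heq _ _).symm.trans (this.trans (eqToHom_comp_heq _ _))
    refine HEq.trans ?_ (key' (𝟙 B))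
    have hη : η ≍ 𝟙 B ◁ η := by
      rw [id_whiskerLeft, Strict.leftUnitor_eqToIso, Strict.leftUnitor_eqToIso]
      simp only [eqToIso.hom, eqToIso.inv, heq_eqToHom_comp_iff, heq_comp_eqToHom_iff, heq_eq_eq]
    have hσ {x y x' y' : (reprTwo B).obj D} (f : x ⟶ y) (g : x' ⟶ y') (hx : x = x')
        (hy : y = y') (h : f ≍ g) : (σ.app D).toFunctor.map f ≍ (σ.app D).toFunctor.map g := by
      subst hx hy h
      rfl
    exact hσ _ _ (Strict.id_comp t).symm (Strict.id_comp t').symm hη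
  refine TwoNat.ext_app fun D => Cat.ext (CategoryTheory.Functor.hext ?_ ?_)
  · exact fun t => (hobj σ t).trans ((congrArg _ h).trans (hobj τ t).symm)
  · refine fun t t' η => (hmap σ η).trans (HEq.trans ?_ (hmap τ η).symm)
    rw [h]

end Representables

/-- The pasting of the square from `exists_comp_moveIso` with a square of associators in `C`, as
needed to verify `exists_lift`. -/
lemma comp_map_square {A : Type u₁} [Category.{v₁} A] {D : Type u₂} [Category.{v₂} D] {F : A ⥤ D}
    {a b a' b' : A} {x y : D} {f : x ⟶ y} {m : x ⟶ F.obj a} {n : y ⟶ F.obj b} {θ : a ⟶ b}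
    {p : a ⟶ a'} {q : b ⟶ b'} {η : a' ⟶ b'} (h : f ≫ n = m ≫ F.map θ) (h' : θ ≫ q = p ≫ η) :
    f ≫ n ≫ F.map q = (m ≫ F.map p) ≫ F.map η := by
  rw [reassoc_of% h, Category.assoc, ← F.map_comp, ← F.map_comp, h']

/-! ### The projections of a 2-pro-object form a projection system -/

namespace TwoProObj

variable {C : Type u} [Bicategory.{v, v} C] [Strict C] (X : TwoProObj C)

/-- `X_u` for a 1-cell `u` of the index. -/
abbrev res {i k : X.Idx} (u : i ⟶ k) : X.val k ⟶ X.val i :=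
  TwoColim.res X.diag.toPseudofunctor u

/-- By Yoneda it suffices to compare values at `𝟙 B`. These are `(r, i)` and `(r ≫ 𝟙 B, i)`, which
are equal because `C` is strict. -/
lemma eq_yoMap_comp_incl {B : C} {i : X.Idx} {r : X.val i ⟶ B}
    (σ : TwoHom.mk (reprTwo B) ⟶ X.L)
    (h : (σ.app B).toFunctor.obj (𝟙 B) =
      (⟨i, r⟩ : TwoColim.Obj X.diag.toPseudofunctor B)) :
    σ = yoMap r ≫ X.incl i :=
  TwoHom.hom_ext_of_repr (h.trans (congrArg (TwoColim.Obj.mk i) (Strict.comp_id r).symm))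

/-- The isomorphism of inclusions induced by `u : i ⟶ k`. -/
noncomputable def inclIso {i k : X.Idx} (u : i ⟶ k) : X.incl i ≅ yoMap (X.res u) ≫ X.incl k :=
  TwoHom.isoMk (fun B => Cat.Hom.isoMk (NatIso.ofComponents
    (fun r : X.val i ⟶ B => TwoColim.moveIso u r)
      (fun θ => TwoColim.moveIso_naturality u θ))) (by
    intro B B' f
    -- The modification axiom is `post_map_moveIso`: in the strict setting the associator there is
    -- the identification required by 2-naturality.
    have h (r : X.val i ⟶ B) : (TwoColim.moveIso u (r ≫ f)).hom ≫ eqToHom (congrArg (TwoColim.Obj.mk k)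
        (Strict.assoc (X.res u) r f).symm) =
        (TwoColim.post f).map (TwoColim.moveIso (X := X.diag.toPseudofunctor) u r).hom := by
      rw [TwoColim.post_map_moveIso, TwoColim.eqToHom_incl (Strict.assoc (X.res u) r f).symm,
        Strict.associator_eqToIso]
      rfl
    refine Cat.Hom₂.ext (NatTrans.ext (funext fun r : (reprTwo (X.val i)).obj B => ?_))
    rw [Cat.Hom₂.comp_app, Cat.Hom₂.comp_app, Cat.eqToHom_app, Cat.eqToHom_app]
    exact (h r).trans (Category.id_comp _).symm)

/-- Whiskering `inclIso` with `yoMap r` evaluates it at `r ≫ t`, the middle associator of `shift` is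
an identity on components, and the comparison for `X_u ≫ r` contributes the inverse associator of
`C`. -/
lemma shift_inclIso_app {i k : X.Idx} (u : i ⟶ k) {B D : C} (r : X.val i ⟶ B) (t : B ⟶ D) :
    (TwoNat.Modif.app (Hom2.unop2 (KCat.shift (c := (yonedaTwo C).toPseudofunctor)
      (p := X.proj i) (q := X.proj k) (X.inclIso u).op2 r).hom) D).toNatTrans.app t =
      (TwoColim.moveIso u (r ≫ t)).hom ≫
        (TwoColim.incl _ D k).map (α_ (X.res u) r t).inv := by
  have h : (TwoNat.Modif.app (Hom2.unop2 ((yonedaTwo C).mapComp (X.res u) r).inv)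
      D).toNatTrans.app t = (α_ (X.res u) r t).inv := by
    have h' : Hom2.unop2 ((yonedaTwo C).mapComp (X.res u) r).inv =
        eqToHom (yoMap_comp (X.res u) r).symm :=
      congrArg Hom2.unop2 (op2_eqToHom (yoMap_comp (X.res u) r).symm).symm
    rw [h', TwoHom.eqToHom_app, Strict.associator_eqToIso]
    erw [Cat.eqToHom_app]
    rfl
  have h' := congrArg (TwoColim.incl X.diag.toPseudofunctor D k).map h
  refine Eq.trans ?_ (congrArg ((TwoColim.moveIso u (r ≫ t)).hom ≫ ·) h')
  exact congrArg ((TwoColim.moveIso u (r ≫ t)).hom ≫ ·) (Category.id_comp _)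

/-- Evaluation at `𝟙 B` translates the four conditions into statements about `(L X)(B)`, which
follow from the 2-filteredness of the index of `X`. -/
lemma isProjectionSystem_proj : KCat.IsProjectionSystem (c := (yonedaTwo C).toPseudofunctor) (fun i => X.proj i) where
  exists_factor {B} h := by
    let x : TwoColim.Obj X.diag.toPseudofunctor B := (h.unop.app B).toFunctor.obj (𝟙 B)
    exact ⟨x.idx, x.arr, ⟨eqToIso (congrArg Quiver.Hom.op (X.eq_yoMap_comp_incl h.unop rfl))⟩⟩
  exists_common i i' := by
    obtain ⟨k, ⟨u⟩, ⟨u'⟩⟩ := IsTwoFiltered.f0 i i'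
    exact ⟨k, X.res u, X.res u', ⟨(X.inclIso u).op2⟩, ⟨(X.inclIso u').op2⟩⟩
  exists_lift {i B r s} γ := by
    let f : (⟨i, r ≫ 𝟙 B⟩ : TwoColim.Obj X.diag.toPseudofunctor B) ⟶ ⟨i, s ≫ 𝟙 B⟩ :=
      (γ.unop2.app B).toNatTrans.app (𝟙 B)
    obtain ⟨k, u, θ, h⟩ := TwoColim.exists_comp_moveIso f
    -- Evaluation at `𝟙 B` yields `r ≫ 𝟙 B` and `s ≫ 𝟙 B` in place of `r` and `s`, so the 2-cell
    -- found is conjugated by right unitors.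
    refine ⟨k, X.res u, (X.inclIso u).op2, X.res u ◁ (ρ_ r).inv ≫ θ ≫ X.res u ◁ (ρ_ s).hom, ?_⟩
    have hθ : θ ≫ (α_ (X.res u) s (𝟙 B)).inv = (α_ (X.res u) r (𝟙 B)).inv ≫
        (X.res u ◁ (ρ_ r).inv ≫ θ ≫ X.res u ◁ (ρ_ s).hom) ▷ 𝟙 B := by
      simp
    have key := comp_map_square (F := TwoColim.incl X.diag.toPseudofunctor B k)
      (m := (TwoColim.moveIso u (r ≫ 𝟙 B)).hom) (n := (TwoColim.moveIso u (s ≫ 𝟙 B)).hom) h hθ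
    refine congrArg op2 (TwoHom.hom₂_ext_of_repr (B := B) ?_)
    exact (congrArg (f ≫ ·) (X.shift_inclIso_app u s (𝟙 B))).trans (key.trans (congrArg (· ≫
      (TwoColim.incl _ B k).map ((X.res u ◁ (ρ_ r).inv ≫ θ ≫ X.res u ◁ (ρ_ s).hom) ▷ 𝟙 B))
        (X.shift_inclIso_app u r (𝟙 B))).symm)
  exists_eq {i B r s θ θ'} h := by
    have h' : (TwoColim.incl _ B i).map (θ ▷ 𝟙 B) = (TwoColim.incl _ B i).map (θ' ▷ 𝟙 B) :=
      congrArg (fun m : X.proj i ≫ (yonedaTwo C).map r ⟶ X.proj i ≫ (yonedaTwo C).map s =>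
        (TwoNat.Modif.app (show yoMap r ≫ X.incl i ⟶ yoMap s ≫ X.incl i from Hom2.unop2 m)
          B).toNatTrans.app (𝟙 B)) h
    obtain ⟨k, u, h⟩ := TwoColim.exists_whiskerLeft_eq h'
    refine ⟨k, X.res u, (X.inclIso u).op2, ?_⟩
    -- The 2-cells compared are `θ ▷ 𝟙 B` and `θ' ▷ 𝟙 B`; the invertible unitors around `θ` and `θ'`
    -- cancel.
    simp only [whiskerRight_id, whiskerLeft_comp] at h
    simpa using h

end TwoProObj

/-- The hom categories of `2-Pro(C)` are those of `Hom(C, Cat)ᵒᵖ`, so the criterion applies there to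
the projections of each `X^j`. -/
theorem mainTheorem5 {C : Type u} [Bicategory.{v, v} C] [Bicategory.Strict C]
    {J : Type v} [Bicategory.{v, v} J] [Bicategory.Strict J] [IsTwoFiltered J]
    (X : StrictPseudofunctor Jᵒᵖ (TwoPro C)) : IsTwoFiltered (KX X) :=
  KCat.isTwoFiltered fun j => (pro X j).isProjectionSystem_proj
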